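/- Let $M$ be a connected (Hausdorff, second countable) $C^\infty$-manifold without boundary of dimension $n\ge 2$, and let $F:TM\to[0,\infty)$ be a $C^\infty$-Finsler structure: $F$ is $C^\infty$ on $TM\setminus\{0\}$, $F(cv)=cF(v)$ for all $c\ge 0$, and for every $v\in TM\setminus\{0\}$ the matrix $\bigl(\tfrac12\,\partial^2[F^2]/\partial v^i\partial v^j(v)\bigr)_{i,j}$ is positive definite ($F(-v)\ne F(v)$ is allowed). Let $$d(x,y)=\inf_\eta\int_0^1F(\dot\eta(t))\,dt,$$ where the infimum is over piecewise $C^1$-curves $\eta:[0,1]\to M$ from $x$ to $y$. Assume that the reversibility constant $\Lambda_F=\sup_{v\in TM\setminus\{0\}}F(v)/F(-v)$ is finite and that $(M,F)$ is complete, i.e. every closed set $A\subset M$ with $\sup_{y\in A}d(x,y)<\infty$ for some $x\in M$ is compact. Let $\mathsf m$ be a measure on $M$ having a positive $C^\infty$ density with respect to Lebesgue measure in every local chart. Put $F^*(\alpha)=\sup\{\alpha(v):v\in T_xM,\ F(v)=1\}$ for $\alpha\in T_x^*M$, and $$\mathbb L=\{f\in H^1_{\mathrm{loc}}(M)\cap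 L^\infty(M): F^*(-\mathbf df)\le 1\ \text{a.e.}\},$$ $$\mathbb L_{B,R}=\{f\in\mathbb L: f=0\ \text{a.e. on }B,\ 0\le f\le R\ \text{a.e.}\}.$$ Here $H^1_{\mathrm{loc}}(M)$ is defined through local charts and $\mathbf d f$ is the weak differential. For $A,B\subset M$ set $d_B(x)=\inf_{y\in B}d(x,y)$, $d(A,B)=\inf_{x\in A,\,y\in B}d(x,y)$, $d_{\mathsf m}(A,B)=\operatorname{ess\,inf}_{x\in A}d_B(x)$ and $$\bar d_{\mathsf m}(A,B)=\sup_{f\in\mathbb L}\Bigl\{\operatorname{ess\,inf}_{x\in A}f(x)-\operatorname{ess\,sup}_{y\in B}f(y)\Bigr\},$$ with the conventions $\inf\emptyset=\infty$ and $\sup\emptyset=-\infty$ (so that $\infty-(-\infty)=\infty$) when $A$ or $B$ is empty. For every open set $B\subset M$, there is a measurable function $\bar d_B:M\to[0,\infty]$ such that, for every $R>0$, $\bar d_B\wedge R$ is the maximal element of $\mathbb L_{B,R}$ (that is, $\bar d_B\wedge R\in\mathbb L_{B,R}$, and $f\le\bar d_B\wedge R$ a.e. for every $f\in\mathbb L_{B,R}$),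 and every such function satisfies $\bar d_B=d_B$ a.e. Moreover, for all open sets $A,B\subset M$, $$\bar d_{\mathsf m}(A,B)=d_{\mathsf m}(A,B)=d(A,B).$$ -/

import Mathlib

open MeasureTheory Set
open scoped Manifold ContDiff ENNReal

noncomputable section

namespace FinslerVaradhan

variable {n : ℕ} {M : Type*} [TopologicalSpace M] [ChartedSpace (EuclideanSpace ℝ (Fin n)) M]

/-- A `C^∞`-Finsler structure on the (boundaryless) `n`-dimensional smooth manifold `M`. -/
structure FinslerStructure (n : ℕ) (M : Type*) [TopologicalSpace M]
    [ChartedSpace (EuclideanSpace ℝ (Fin n)) M] [IsManifold (𝓡 n) ∞ M] where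
  /-- the value of the Finsler structure on a tangent vector at a point -/
  toFun : (x : M) → TangentSpace (𝓡 n) x → ℝ
  nonneg : ∀ (x : M) (v : TangentSpace (𝓡 n) x), 0 ≤ toFun x v
  /-- smoothness on the tangent bundle without the zero section -/
  smooth : ContMDiffOn (𝓡 n).tangent 𝓘(ℝ, ℝ) ∞
    (fun p : TangentBundle (𝓡 n) M => toFun p.1 p.2) {p | p.2 ≠ 0}
  /-- positive 1-homogeneity -/
  homogeneous : ∀ (x : M) (v : TangentSpace (𝓡 n) x) (c : ℝ), 0 ≤ c →
    toFun x (c • v) = c * toFun x v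
  /-- strong convexity: the Hessian of `F ^ 2 / 2` along the fibre is positive definite at
  every nonzero vector. The fibre over `x` is, as a vector space, the model space; a change of
  fibre-wise linear coordinates does not affect positive definiteness. -/
  strongly_convex : ∀ (x : M) (v w : EuclideanSpace ℝ (Fin n)), v ≠ 0 → w ≠ 0 →
    0 < fderiv ℝ (fderiv ℝ
      (fun u : EuclideanSpace ℝ (Fin n) => (1 / 2 : ℝ) * toFun x u ^ 2)) v w w

/-- A curve `η : [0, 1] → M` (its values outside `[0, 1]` are irrelevant) is piecewise `C^1`:
it is continuous, and `C^1` up to the end points on each closed piece of some finite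
subdivision of `[0, 1]`. -/
def IsPiecewiseC1 (n : ℕ) {M : Type*} [TopologicalSpace M]
    [ChartedSpace (EuclideanSpace ℝ (Fin n)) M] (η : ℝ → M) : Prop :=
  ContinuousOn η (Icc 0 1) ∧
    ∃ (k : ℕ) (t : ℕ → ℝ), Monotone t ∧ t 0 = 0 ∧ t k = 1 ∧
      ∀ i < k, ContMDiffOn 𝓘(ℝ, ℝ) (𝓡 n) 1 η (Icc (t i) (t (i + 1)))

/-- A covector field, i.e. a (not necessarily continuous) section of the cotangent bundle. -/
abbrev CovectorField (n : ℕ) (M : Type*) [TopologicalSpace M]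
    [ChartedSpace (EuclideanSpace ℝ (Fin n)) M] : Type _ :=
  (x : M) → (TangentSpace (𝓡 n) x →L[ℝ] ℝ)

/-- The expression of a covector field in the chart `φ`, i.e. its pull-back under `φ⁻¹`. -/
def inChart (φ : OpenPartialHomeomorph M (EuclideanSpace ℝ (Fin n))) (θ : CovectorField n M)
    (y : EuclideanSpace ℝ (Fin n)) : EuclideanSpace ℝ (Fin n) →L[ℝ] ℝ :=
  (θ (φ.symm y)).comp (mfderiv 𝓘(ℝ, EuclideanSpace ℝ (Fin n)) (𝓡 n) φ.symm y)

/-- `u ∈ L²_loc(U)`: square integrability on compact subsets of `U`. -/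
def MemL2Loc {V : Type*} [NormedAddCommGroup V] (U : Set (EuclideanSpace ℝ (Fin n)))
    (u : EuclideanSpace ℝ (Fin n) → V) : Prop :=
  ∀ K ⊆ U, IsCompact K → MemLp u 2 (volume.restrict K)

/-- `G` is the weak (distributional) differential of `u` on the open set `U`. -/
def IsWeakDerivOn (U : Set (EuclideanSpace ℝ (Fin n)))
    (u : EuclideanSpace ℝ (Fin n) → ℝ)
    (G : EuclideanSpace ℝ (Fin n) → (EuclideanSpace ℝ (Fin n) →L[ℝ] ℝ)) : Prop :=
  ∀ ψ : EuclideanSpace ℝ (Fin n) → ℝ, ContDiff ℝ ∞ ψ → HasCompactSupport ψ → tsupport ψ ⊆ U →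
    ∀ v : EuclideanSpace ℝ (Fin n), ∫ y, u y * fderiv ℝ ψ y v = -∫ y, G y v * ψ y

/-- `f ∈ H¹_loc(M)` with weak differential `𝐝f = θ`: in each chart, `f` and the expression of
`θ` are locally square integrable and the latter is the weak differential of the former. -/
def HasH1LocDifferential (f : M → ℝ) (θ : CovectorField n M) : Prop :=
  ∀ φ ∈ IsManifold.maximalAtlas (𝓡 n) ∞ M,
    MemL2Loc φ.target (f ∘ φ.symm) ∧ MemL2Loc φ.target (inChart φ θ) ∧
      IsWeakDerivOn φ.target (f ∘ φ.symm) (inChart φ θ)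

/-- `m` is a positive `C^∞`-measure: in each chart it has a positive smooth density with respect
to the Lebesgue measure. -/
def IsSmoothPositiveMeasure (n : ℕ) {M : Type*} [TopologicalSpace M]
    [ChartedSpace (EuclideanSpace ℝ (Fin n)) M] [MeasurableSpace M] (m : Measure M) : Prop :=
  ∀ φ ∈ IsManifold.maximalAtlas (𝓡 n) ∞ M,
    ∃ ρ : EuclideanSpace ℝ (Fin n) → ℝ, ContDiffOn ℝ ∞ ρ φ.target ∧ (∀ y ∈ φ.target, 0 < ρ y) ∧
      ∀ s ⊆ φ.source, MeasurableSet s → m s = ∫⁻ y in φ '' s, ENNReal.ofReal (ρ y)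

namespace FinslerStructure

variable [IsManifold (𝓡 n) ∞ M] (F : FinslerStructure n M)

/-- The length `∫₀¹ F(η'(t)) dt` of a piecewise `C^1` curve; at the finitely many break points
the value of the integrand is irrelevant. -/
def length (η : ℝ → M) : ℝ≥0∞ :=
  ∫⁻ t in Icc (0 : ℝ) 1, ENNReal.ofReal (F.toFun (η t) (mfderiv 𝓘(ℝ, ℝ) (𝓡 n) η t (1 : ℝ)))

/-- The (asymmetric) distance from `x` to `y`: the infimum of the lengths of the piecewise `C^1`
curves from `x` to `y` (finite as soon as `M` is connected). -/
def dist (x y : M) : ℝ≥0∞ :=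
  ⨅ (η : ℝ → M) (_ : IsPiecewiseC1 n η ∧ η 0 = x ∧ η 1 = y), F.length η

/-- The reversibility constant `sup F(v) / F(-v)` over the nonzero tangent vectors. -/
def reversibility : ℝ≥0∞ :=
  ⨆ (x : M) (v : TangentSpace (𝓡 n) x) (_ : v ≠ 0),
    ENNReal.ofReal (F.toFun x v / F.toFun x (-v))

/-- Forward completeness: closed forward bounded sets are compact. (When the reversibility
constant is finite, this is the same as backward completeness and is called completeness.) -/
def IsForwardComplete : Prop :=
  ∀ A : Set M, IsClosed A → (∃ x : M, (⨆ y ∈ A, F.dist x y) < ⊤) → IsCompact A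

/-- The dual norm `F*(α) = sup {α(v) : F(v) = 1}`. -/
def dual (x : M) (α : TangentSpace (𝓡 n) x →L[ℝ] ℝ) : EReal :=
  ⨆ (v : TangentSpace (𝓡 n) x) (_ : F.toFun x v = 1), ((α v : ℝ) : EReal)

variable [MeasurableSpace M] (m : Measure M)

/-- The class `𝕃` of the functions `f ∈ H¹_loc(M) ∩ L^∞(M)` with `F*(-𝐝f) ≤ 1` a.e. (The weak
differential is a.e. unique.) -/
def sobolevClass : Set (M → ℝ) :=
  {f | MemLp f ⊤ m ∧ ∃ θ : CovectorField n M, HasH1LocDifferential f θ ∧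
    ∀ᵐ x ∂m, F.dual x (-θ x) ≤ 1}

/-- The class `𝕃_{B,R}` of the `f ∈ 𝕃` with `f = 0` a.e. on `B` and `0 ≤ f ≤ R` a.e. -/
def sobolevClassVanishing (B : Set M) (R : ℝ) : Set (M → ℝ) :=
  {f | f ∈ F.sobolevClass m ∧ (∀ᵐ x ∂m.restrict B, f x = 0) ∧ ∀ᵐ x ∂m, 0 ≤ f x ∧ f x ≤ R}

/-- `g` is (a representative of) the maximal function `d̄_B`: for every `R > 0`, the truncation
`g ∧ R` is the maximal element of `𝕃_{B,R}`. -/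
structure IsMaximalSobolevDist (B : Set M) (g : M → ℝ≥0∞) : Prop where
  measurable : Measurable g
  mem : ∀ R : ℝ, 0 < R →
    (fun x => (min (g x) (ENNReal.ofReal R)).toReal) ∈ F.sobolevClassVanishing m B R
  maximal : ∀ R : ℝ, 0 < R → ∀ f ∈ F.sobolevClassVanishing m B R,
    ∀ᵐ x ∂m, f x ≤ (min (g x) (ENNReal.ofReal R)).toReal

/-- `d̄_m(A, B) = sup_{f ∈ 𝕃} (essinf_A f - esssup_B f)`. -/
def sobolevSetDist (A B : Set M) : EReal :=
  ⨆ f ∈ F.sobolevClass m,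
    essInf (fun x => (f x : EReal)) (m.restrict A) - essSup (fun x => (f x : EReal)) (m.restrict B)

/-- `d_B(x) = inf_{y ∈ B} d(x, y)`. -/
def distTo (B : Set M) (x : M) : ℝ≥0∞ := ⨅ y ∈ B, F.dist x y

/-- `d_m(A, B) = essinf_{x ∈ A} inf_{y ∈ B} d(x, y)`. -/
def essSetDist (A B : Set M) : ℝ≥0∞ := essInf (F.distTo B) (m.restrict A)

/-- `d(A, B) = inf_{x ∈ A, y ∈ B} d(x, y)`. -/
def setDist (A B : Set M) : ℝ≥0∞ := ⨅ (x ∈ A) (y ∈ B), F.dist x y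

end FinslerStructure

end FinslerVaradhan

end

set_option linter.unusedSectionVars false

noncomputable section

open Filter Topology

namespace FinslerVaradhan

variable {n : ℕ} {M : Type*} [TopologicalSpace M] [ChartedSpace (EuclideanSpace ℝ (Fin n)) M]

local notation "𝔼" => EuclideanSpace ℝ (Fin n)

/-! ### Positivity, duality and continuity of the Finsler norm -/

namespace FinslerStructure

variable [IsManifold (𝓡 n) ∞ M] (F : FinslerStructure n M)

/-! The heart of the matter is a Rademacher-type identification: up to null sets, the class `𝕃`
consists of the bounded functions `g` with `g x - g y ≤ d(x, y)`. The sign in `F*(-𝐝f) ≤ 1` means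
`-𝐝f(v) ≤ F(v)`, so along a curve `f` drops by at most the length; this is why `x` comes first in
`d(x, y)`.

Both sides are compared with the local condition `HasSlopeBound`: near `z₀` in a chart, increments
are controlled by the norm frozen at `z₀`, up to an error `δ‖·‖`. Integrating along curves turns it
into the Lipschitz bound for `d` (`HasSlopeBound.ofReal_sub_le_dist`), and straight chart segments
give the converse (`hasSlopeBound_of_ofReal_sub_le`). A slope-bounded function is locally Lipschitz
in charts, so Rademacher's theorem puts it in `𝕃` when it is bounded
(`HasSlopeBound.mem_sobolevClass`). Conversely, mollifying an element of `𝕃` in a chart bounds its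
increments off a null set (`exists_ae_sub_le_of_weakDeriv`), hence it has a continuous slope-bounded
representative (`exists_lipschitz_representative`).

The rest is soft. By the triangle inequality `d_B ∧ R` lies in `𝕃`. It is maximal because a
continuous representative `g` of a competitor is at most `0` on the open set `B`, whence `g x ≤ g x
- g y ≤ d(x, y)` for `y ∈ B`. Maximal elements are a.e. unique. For the set distances, continuity
turns essential bounds on open sets into pointwise ones, the Lipschitz bound gives `≤`, and the test
functions `d_B ∧ k` give `≥` as `k → ∞`. -/

theorem map_zero (x : M) : F.toFun x (0 : 𝔼) = 0 := by
  have h := F.homogeneous x (0 : TangentSpace (𝓡 n) x) 0 le_rfl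
  rwa [smul_zero, zero_mul] at h

/-- If `F(v) = 0`, then `v` minimises `g = F² / 2`, so `dg(v) = 0`. Since `dg` is positively
1-homogeneous, Euler's relation gives `D²g(v) v = dg(v) = 0`, against strong convexity. -/
theorem pos (x : M) {v : 𝔼} (hv : v ≠ 0) : 0 < F.toFun x v := by
  set g : 𝔼 → ℝ := fun u => (1 / 2 : ℝ) * F.toFun x u ^ 2 with hg
  have hconv : 0 < fderiv ℝ (fderiv ℝ g) v v v := F.strongly_convex x v v hv hv
  refine (F.nonneg x v).lt_of_ne fun h0 => ?_
  have hscale : ∀ s : ℝ, 0 < s → ∀ u : 𝔼, fderiv ℝ g (s • u) = s • fderiv ℝ g u := by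
    intro s hs u
    have h1 : (fun w : 𝔼 => g (s • w)) = (s ^ 2) • g := by
      funext w
      have := F.homogeneous x w s hs.le
      simp only [hg, Pi.smul_apply, smul_eq_mul]
      erw [this]
      ring
    have h2 : fderiv ℝ (fun w : 𝔼 => g (s • w)) u = s • fderiv ℝ g (s • u) :=
      fderiv_comp_smul s
    rw [h1, fderiv_const_smul_field] at h2
    have hs' : s ≠ 0 := hs.ne'
    have h3 : s • fderiv ℝ g (s • u) = s • (s • fderiv ℝ g u) := by
      rw [← h2, smul_smul, pow_two]
      rfl
    exact smul_right_injective _ hs' h3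
  -- Strong convexity itself yields differentiability: otherwise the second `fderiv` would be the
  -- default value `0`.
  have hdiff : DifferentiableAt ℝ (fderiv ℝ g) v := by
    by_contra h
    simp [fderiv_zero_of_not_differentiableAt h] at hconv
  have hray : HasDerivAt (fun s : ℝ => s • v) v 1 := by
    simpa using (hasDerivAt_id (1 : ℝ)).smul_const v
  have hd1 : HasDerivAt (fun s : ℝ => fderiv ℝ g (s • v)) (fderiv ℝ (fderiv ℝ g) v v) 1 := by
    have hdv : HasFDerivAt (fderiv ℝ g) (fderiv ℝ (fderiv ℝ g) v) ((1 : ℝ) • v) := by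
      simpa using hdiff.hasFDerivAt
    exact hdv.comp_hasDerivAt (1 : ℝ) hray
  have hd2 : HasDerivAt (fun s : ℝ => fderiv ℝ g (s • v)) (fderiv ℝ g v) 1 := by
    have : HasDerivAt (fun s : ℝ => s • fderiv ℝ g v) (fderiv ℝ g v) 1 := by
      simpa using (hasDerivAt_id (1 : ℝ)).smul_const (fderiv ℝ g v)
    refine this.congr_of_eventuallyEq ?_
    filter_upwards [lt_mem_nhds (zero_lt_one : (0 : ℝ) < 1)] with s hs using hscale s hs v
  have hmin : IsLocalMin g v := by
    refine Eventually.of_forall fun w => ?_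
    have h1 : g v = 0 := by simp [hg, ← h0]
    rw [h1]
    exact mul_nonneg (by norm_num) (sq_nonneg _)
  rw [hd1.unique hd2, hmin.fderiv_eq_zero] at hconv
  simp at hconv

theorem le_of_dual_le_one {x : M} {α : TangentSpace (𝓡 n) x →L[ℝ] ℝ} (h : F.dual x α ≤ 1)
    (v : TangentSpace (𝓡 n) x) : α v ≤ F.toFun x v := by
  by_cases hv : v = 0
  · subst hv
    rw [_root_.map_zero]
    exact F.nonneg x 0
  have hpos : 0 < F.toFun x v := F.pos x hv
  have h1 : F.toFun x ((F.toFun x v)⁻¹ • v) = 1 := by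
    rw [F.homogeneous x v _ (inv_nonneg.2 hpos.le), inv_mul_cancel₀ hpos.ne']
  have h2 : ((α ((F.toFun x v)⁻¹ • v) : ℝ) : EReal) ≤ 1 :=
    le_trans (le_iSup₂_of_le (f := fun (w : TangentSpace (𝓡 n) x) (_ : F.toFun x w = 1) =>
      ((α w : ℝ) : EReal)) _ h1 le_rfl) h
  have h3 : α ((F.toFun x v)⁻¹ • v) ≤ 1 := by exact_mod_cast h2
  rw [map_smul, smul_eq_mul, inv_mul_le_iff₀ hpos] at h3
  simpa using h3

theorem dual_le_one_of_le {x : M} {α : TangentSpace (𝓡 n) x →L[ℝ] ℝ}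
    (h : ∀ v : TangentSpace (𝓡 n) x, α v ≤ F.toFun x v) : F.dual x α ≤ 1 := by
  refine iSup₂_le fun v hv => ?_
  have := h v
  rw [hv] at this
  exact_mod_cast this

/-- Smoothness covers only nonzero vectors. At the zero section, compactness of the unit sphere in a
trivialisation bounds `F` on unit vectors uniformly for nearby base points, and homogeneity gives `F
≤ C‖v‖` there. -/
theorem continuous_toFun : Continuous fun p : TangentBundle (𝓡 n) M => F.toFun p.1 p.2 := by
  rw [continuous_iff_continuousAt]
  intro p₀
  set e := trivializationAt 𝔼 (TangentSpace (𝓡 n) : M → Type _) p₀.1 with he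
  have hp₀ : p₀.1 ∈ e.baseSet := FiberBundle.mem_baseSet_trivializationAt' p₀.1
  set G : M × 𝔼 → ℝ := fun q => F.toFun q.1 (e.symm q.1 q.2) with hG
  have hGF : ∀ p : TangentBundle (𝓡 n) M, p.1 ∈ e.baseSet → F.toFun p.1 p.2 = G (e p) := by
    intro p hp
    have h1 : (e p).1 = p.1 := e.coe_fst' hp
    simp only [hG]
    have := e.symm_apply_apply_mk hp p.2
    have h2 : e p = (p.1, (e p).2) := Prod.ext h1 rfl
    rw [h2]
    simp only
    rw [show e.symm p.1 (e p).2 = p.2 from this]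
  have hsmul : ∀ x ∈ e.baseSet, ∀ (c : ℝ) (v : 𝔼), 0 ≤ c → G (x, c • v) = c * G (x, v) := by
    intro x hx c v hc
    simp only [hG]
    rw [← F.homogeneous x _ c hc]
    congr 1
    have := (e.symmₗ ℝ x).map_smul c v
    rwa [e.coe_symmₗ (R := ℝ) hx] at this
  have hGcont : ∀ q : M × 𝔼, q.1 ∈ e.baseSet → q.2 ≠ 0 → ContinuousAt G q := by
    intro q hq hq2
    have hop : IsOpen (e.baseSet ×ˢ ({0}ᶜ : Set 𝔼)) := e.open_baseSet.prod isOpen_compl_singleton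
    have hmem : e.baseSet ×ˢ ({0}ᶜ : Set 𝔼) ∈ 𝓝 q := hop.mem_nhds ⟨hq, hq2⟩
    have h1 : ContinuousOn (fun q : M × 𝔼 => (⟨q.1, e.symm q.1 q.2⟩ : TangentBundle (𝓡 n) M))
        (e.baseSet ×ˢ univ) := e.continuousOn_symm
    have h2 := F.smooth.continuousOn
    have h3 : ContinuousOn G (e.baseSet ×ˢ ({0}ᶜ : Set 𝔼)) := by
      refine h2.comp (h1.mono (prod_mono le_rfl (subset_univ _))) ?_
      rintro ⟨x, v⟩ ⟨hx, hv⟩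
      rw [mem_ofPred_eq]
      intro h0
      apply hv
      have h4 := e.apply_mk_symm hx v
      simp only at h0 h4
      rw [h0] at h4
      have h5 : (e ⟨x, 0⟩).2 = 0 := by
        have := (e.linearMapAt ℝ x).map_zero
        rw [Bundle.Trivialization.coe_linearMapAt_of_mem _ hx] at this
        exact this
      rw [h4] at h5
      exact h5
    exact h3.continuousAt hmem
  have hGcont0 : ∀ x ∈ e.baseSet, ContinuousAt G (x, 0) := by
    intro x hx
    set K : Set 𝔼 := Metric.sphere 0 1
    have hK : IsCompact K := isCompact_sphere 0 1
    obtain ⟨C, hC⟩ : ∃ C, ∀ v ∈ K, G (x, v) < C := by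
      have : ContinuousOn (fun v => G (x, v)) K := fun v hv => by
        have hv0 : v ≠ 0 := by
          rintro rfl
          simp [K] at hv
        exact ((hGcont (x, v) hx hv0).comp (by fun_prop : ContinuousAt (fun v : 𝔼 => (x, v)) v)
          ).continuousWithinAt
      obtain ⟨C, hC⟩ := (hK.image_of_continuousOn this).bddAbove
      exact ⟨C + 1, fun v hv => lt_of_le_of_lt (hC (mem_image_of_mem _ hv)) (lt_add_one C)⟩
    have hev : ∀ᶠ y in 𝓝 x, ∀ v ∈ K, G (y, v) < C := by
      refine hK.eventually_forall_of_forall_eventually fun v hv => ?_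
      have hv0 : v ≠ 0 := by
        rintro rfl
        simp [K] at hv
      exact (hGcont (x, v) hx hv0).eventually_lt_const (hC v hv)
    have hb : ∀ᶠ q : M × 𝔼 in 𝓝 (x, 0), G q ≤ C * ‖q.2‖ := by
      have h1 : ∀ᶠ q : M × 𝔼 in 𝓝 (x, 0), q.1 ∈ e.baseSet ∧ ∀ v ∈ K, G (q.1, v) < C :=
        (continuousAt_fst (p := ((x, 0) : M × 𝔼))).eventually ((show ∀ᶠ y in 𝓝 x, y ∈ e.baseSet from
          e.open_baseSet.mem_nhds hx).and hev)
      filter_upwards [h1] with q hq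
      by_cases h0 : q.2 = 0
      · have := hsmul q.1 hq.1 0 0 le_rfl
        rw [zero_smul, zero_mul] at this
        rw [h0, norm_zero, mul_zero, ← this, ← h0]
      · have hn : 0 < ‖q.2‖ := norm_pos_iff.2 h0
        have h2 := hq.2 (‖q.2‖⁻¹ • q.2) (by simp [K, norm_smul, hn.ne'])
        rw [hsmul q.1 hq.1 _ _ (inv_nonneg.2 hn.le), inv_mul_lt_iff₀ hn] at h2
        rw [mul_comm]
        exact h2.le
    have hG0 : G (x, 0) = 0 := by
      have := hsmul x hx 0 0 le_rfl
      rwa [zero_smul, zero_mul] at this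
    rw [ContinuousAt, hG0]
    refine squeeze_zero' (Eventually.of_forall fun q => F.nonneg _ _) hb ?_
    have : Continuous fun q : M × 𝔼 => C * ‖q.2‖ := by fun_prop
    simpa using this.tendsto (x, 0)
  have hGc : ContinuousAt G (e p₀) := by
    have h1 : (e p₀).1 = p₀.1 := e.coe_fst' hp₀
    by_cases h0 : (e p₀).2 = 0
    · have : e p₀ = (p₀.1, 0) := Prod.ext h1 h0
      rw [this]
      exact hGcont0 _ hp₀
    · exact hGcont _ (h1 ▸ hp₀) h0
  have hsrc : p₀ ∈ e.source := e.mem_source.2 hp₀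
  have hcomp : ContinuousAt (fun p => G (e p)) p₀ :=
    ContinuousAt.comp hGc (e.toOpenPartialHomeomorph.continuousAt hsrc)
  refine hcomp.congr ?_
  filter_upwards [e.open_source.mem_nhds hsrc] with p hp
  exact (hGF p (e.mem_source.1 hp)).symm

/-! ### The Finsler norm in charts -/

/-- The Finsler structure read in the chart `φ`. -/
def chartNorm (φ : OpenPartialHomeomorph M (EuclideanSpace ℝ (Fin n))) (z v : 𝔼) : ℝ :=
  F.toFun (φ.symm z) (mfderiv 𝓘(ℝ, 𝔼) (𝓡 n) φ.symm z v)

variable {φ : OpenPartialHomeomorph M (EuclideanSpace ℝ (Fin n))}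

theorem chartNorm_nonneg (z v : 𝔼) : 0 ≤ F.chartNorm φ z v := F.nonneg _ _

theorem chartNorm_smul (z v : 𝔼) {c : ℝ} (hc : 0 ≤ c) :
    F.chartNorm φ z (c • v) = c * F.chartNorm φ z v := by
  unfold chartNorm
  rw [← F.homogeneous _ _ c hc]
  congr 1
  exact (mfderiv 𝓘(ℝ, 𝔼) (𝓡 n) φ.symm z).map_smul c v

theorem chartNorm_zero (z : 𝔼) : F.chartNorm φ z 0 = 0 := by
  simpa using F.chartNorm_smul (φ := φ) z 0 le_rfl

theorem continuousOn_chartNorm (hφ : φ ∈ IsManifold.maximalAtlas (𝓡 n) ∞ M) :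
    ContinuousOn (fun p : 𝔼 × 𝔼 => F.chartNorm φ p.1 p.2) (φ.target ×ˢ univ) := by
  have h1 : ContMDiffOn 𝓘(ℝ, 𝔼) (𝓡 n) ∞ φ.symm φ.target :=
    contMDiffOn_symm_of_mem_maximalAtlas hφ
  have h2 := h1.continuousOn_tangentMapWithin (by simp) φ.open_target.uniqueMDiffOn
  have h3 : ContinuousOn (fun p : 𝔼 × 𝔼 => tangentMapWithin 𝓘(ℝ, 𝔼) (𝓡 n) φ.symm φ.target
      ((tangentBundleModelSpaceHomeomorph 𝓘(ℝ, 𝔼)).symm p)) (φ.target ×ˢ univ) := by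
    refine h2.comp (Homeomorph.continuous _).continuousOn ?_
    rintro ⟨z, v⟩ ⟨hz, -⟩
    exact hz
  refine (F.continuous_toFun.comp_continuousOn h3).congr ?_
  rintro ⟨z, v⟩ ⟨hz, -⟩
  have : mfderivWithin 𝓘(ℝ, 𝔼) (𝓡 n) φ.symm φ.target z = mfderiv 𝓘(ℝ, 𝔼) (𝓡 n) φ.symm z :=
    mfderivWithin_of_isOpen φ.open_target hz
  simp only [chartNorm, Function.comp, tangentMapWithin, tangentBundleModelSpaceHomeomorph]
  rw [← this]
  rfl

/-- The chart expression of a Finsler structure depends on the base point uniformly in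
the direction. -/
theorem eventually_abs_chartNorm_sub_le (hφ : φ ∈ IsManifold.maximalAtlas (𝓡 n) ∞ M)
    {z₀ : 𝔼} (hz₀ : z₀ ∈ φ.target) {δ : ℝ} (hδ : 0 < δ) :
    ∀ᶠ z in 𝓝 z₀, ∀ v, |F.chartNorm φ z v - F.chartNorm φ z₀ v| ≤ δ * ‖v‖ := by
  have hK : IsCompact (Metric.sphere (0 : 𝔼) 1) := isCompact_sphere 0 1
  have hc : ∀ v, ContinuousAt (fun p : 𝔼 × 𝔼 => F.chartNorm φ p.1 p.2) (z₀, v) := fun v =>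
    (F.continuousOn_chartNorm hφ).continuousAt
      ((φ.open_target.prod isOpen_univ).mem_nhds ⟨hz₀, mem_univ _⟩)
  have : ∀ᶠ z in 𝓝 z₀, ∀ v ∈ Metric.sphere (0 : 𝔼) 1,
      |F.chartNorm φ z v - F.chartNorm φ z₀ v| < δ := by
    refine hK.eventually_forall_of_forall_eventually fun v _ => ?_
    have h2 : ContinuousAt (fun p : 𝔼 × 𝔼 => F.chartNorm φ z₀ p.2) (z₀, v) :=
      ContinuousAt.comp (f := fun p : 𝔼 × 𝔼 => (z₀, p.2))
        (g := fun p : 𝔼 × 𝔼 => F.chartNorm φ p.1 p.2) (hc v) (by fun_prop)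
    have h3 := ((hc v).sub h2).abs
    refine h3.eventually_lt_const ?_
    simpa using hδ
  filter_upwards [this] with z hz v
  by_cases h0 : v = 0
  · simp [h0, chartNorm_zero]
  · have hn : 0 < ‖v‖ := norm_pos_iff.2 h0
    have h2 := hz (‖v‖⁻¹ • v) (by simp [norm_smul, hn.ne'])
    rw [F.chartNorm_smul _ _ (inv_nonneg.2 hn.le), F.chartNorm_smul _ _ (inv_nonneg.2 hn.le),
      ← mul_sub, abs_mul, abs_of_pos (inv_pos.2 hn), inv_mul_lt_iff₀ hn] at h2
    linarith

theorem exists_chartNorm_le (hφ : φ ∈ IsManifold.maximalAtlas (𝓡 n) ∞ M)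
    {z₀ : 𝔼} (hz₀ : z₀ ∈ φ.target) : ∃ C : ℝ, 0 < C ∧ ∀ v, F.chartNorm φ z₀ v ≤ C * ‖v‖ := by
  have hK : IsCompact (Metric.sphere (0 : 𝔼) 1) := isCompact_sphere 0 1
  have hc : Continuous fun v => F.chartNorm φ z₀ v :=
    (F.continuousOn_chartNorm hφ).comp_continuous (f := fun v : 𝔼 => (z₀, v)) (by fun_prop)
      (fun v => ⟨hz₀, mem_univ _⟩)
  obtain ⟨C, hC⟩ := (hK.image hc).bddAbove
  refine ⟨max C 1, by positivity, fun v => ?_⟩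
  by_cases h0 : v = 0
  · simp [h0, chartNorm_zero]
  · have hn : 0 < ‖v‖ := norm_pos_iff.2 h0
    have h2 := hC (mem_image_of_mem _ (show ‖v‖⁻¹ • v ∈ Metric.sphere (0 : 𝔼) 1 by
      simp [norm_smul, hn.ne']))
    rw [F.chartNorm_smul _ _ (inv_nonneg.2 hn.le), inv_mul_le_iff₀ hn] at h2
    calc _ ≤ ‖v‖ * C := h2
      _ ≤ max C 1 * ‖v‖ := by rw [mul_comm]; gcongr; exact le_max_left _ _

/-! ### From the slope bound to the Lipschitz bound for the distance -/

/-- `f` is infinitesimally `1`-Lipschitz with respect to `F`, expressed in charts. -/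
def HasSlopeBound (f : M → ℝ) : Prop :=
  ∀ φ ∈ IsManifold.maximalAtlas (𝓡 n) ∞ M, ∀ z₀ ∈ φ.target, ∀ δ : ℝ, 0 < δ →
    ∀ᶠ p : 𝔼 × 𝔼 in 𝓝 (z₀, z₀), f (φ.symm p.1) - f (φ.symm p.2) ≤
      F.chartNorm φ z₀ (p.2 - p.1) + δ * ‖p.2 - p.1‖

theorem toFun_congr {x y : M} (h : x = y) (v : 𝔼) : F.toFun x v = F.toFun y v := by
  subst h; rfl

theorem mdifferentiable_of_mem_maximalAtlas (hφ : φ ∈ IsManifold.maximalAtlas (𝓡 n) ∞ M) :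
    φ.MDifferentiable (𝓡 n) 𝓘(ℝ, 𝔼) :=
  ⟨(contMDiffOn_of_mem_maximalAtlas hφ).mdifferentiableOn (by simp),
    (contMDiffOn_symm_of_mem_maximalAtlas hφ).mdifferentiableOn (by simp)⟩

namespace HasSlopeBound

variable {F} {f : M → ℝ}

/-- The one-sided bound holds for both orders of a pair of points, and the frozen norm is dominated
by a multiple of the Euclidean one, so asymmetry of `F` does no harm. -/
theorem exists_lipschitzOnWith (hf : F.HasSlopeBound f)
    (hφ : φ ∈ IsManifold.maximalAtlas (𝓡 n) ∞ M) {z₀ : 𝔼} (hz₀ : z₀ ∈ φ.target) :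
    ∃ C : NNReal, ∃ r : ℝ, 0 < r ∧ Metric.ball z₀ r ⊆ φ.target ∧
      LipschitzOnWith C (f ∘ φ.symm) (Metric.ball z₀ r) := by
  obtain ⟨C, hC0, hC⟩ := F.exists_chartNorm_le hφ hz₀
  have h1 := hf φ hφ z₀ hz₀ 1 one_pos
  obtain ⟨r₁, hr₁, h1⟩ := Metric.eventually_nhds_iff_ball.1 h1
  simp only [← ball_prod_same] at h1
  obtain ⟨r₂, hr₂, h2⟩ := Metric.isOpen_iff.1 φ.open_target z₀ hz₀
  refine ⟨(C + 1).toNNReal, min r₁ r₂, lt_min hr₁ hr₂,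
    (Metric.ball_subset_ball (min_le_right _ _)).trans h2, ?_⟩
  have key : ∀ x ∈ Metric.ball z₀ (min r₁ r₂), ∀ y ∈ Metric.ball z₀ (min r₁ r₂),
      f (φ.symm x) - f (φ.symm y) ≤ (C + 1) * Dist.dist x y := by
    intro x hx y hy
    have h3 : f (φ.symm x) - f (φ.symm y) ≤ F.chartNorm φ z₀ (y - x) + 1 * ‖y - x‖ :=
      h1 (x, y) ⟨Metric.ball_subset_ball (min_le_left _ _) hx,
        Metric.ball_subset_ball (min_le_left _ _) hy⟩
    have h4 := hC (y - x)
    rw [dist_comm, dist_eq_norm]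
    linarith
  refine LipschitzOnWith.of_dist_le_mul fun x hx y hy => ?_
  rw [Real.dist_eq, abs_le]
  have h3 := key x hx y hy
  have h4 := key y hy x hx
  rw [dist_comm] at h4
  rw [Real.coe_toNNReal _ (by positivity)]
  simp only [Function.comp]
  constructor <;> linarith

theorem continuousAt_comp_symm (hf : F.HasSlopeBound f)
    (hφ : φ ∈ IsManifold.maximalAtlas (𝓡 n) ∞ M) {z₀ : 𝔼} (hz₀ : z₀ ∈ φ.target) :
    ContinuousAt (f ∘ φ.symm) z₀ := by
  obtain ⟨C, r, hr, -, hl⟩ := hf.exists_lipschitzOnWith hφ hz₀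
  exact hl.continuousOn.continuousAt (Metric.ball_mem_nhds _ hr)

theorem continuous (hf : F.HasSlopeBound f) : Continuous f := by
  rw [continuous_iff_continuousAt]
  intro x
  set φ := chartAt 𝔼 x
  have hx : x ∈ φ.source := mem_chart_source 𝔼 x
  have h1 := hf.continuousAt_comp_symm (IsManifold.chart_mem_maximalAtlas x) (φ.map_source hx)
  have h2 : ContinuousAt ((f ∘ φ.symm) ∘ φ) x := ContinuousAt.comp h1 (φ.continuousAt hx)
  refine h2.congr ?_
  filter_upwards [φ.open_source.mem_nhds hx] with y hy
  simp [φ.left_inv hy]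

/-- Along a `C^1` curve, a function satisfying the slope bound decreases at most by the length. -/
theorem ofReal_sub_le_lintegral (hf : F.HasSlopeBound f) {η : ℝ → M} {a b : ℝ} (hab : a ≤ b)
    (hη : ContMDiffOn 𝓘(ℝ, ℝ) (𝓡 n) 1 η (Icc a b)) :
    ENNReal.ofReal (f (η a) - f (η b)) ≤ ∫⁻ t in Icc a b,
      ENNReal.ofReal (F.toFun (η t) (mfderiv 𝓘(ℝ, ℝ) (𝓡 n) η t (1 : ℝ))) := by
  rcases hab.eq_or_lt with rfl | hab
  · simp
  have hud : UniqueDiffOn ℝ (Icc a b) := uniqueDiffOn_Icc hab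
  set L : ℝ → ℝ := fun t => F.toFun (η t) (mfderivWithin 𝓘(ℝ, ℝ) (𝓡 n) η (Icc a b) t (1 : ℝ))
    with hL
  have hLc : ContinuousOn L (Icc a b) := by
    have h2 := hη.continuousOn_tangentMapWithin le_rfl
      (uniqueMDiffOn_iff_uniqueDiffOn.2 hud)
    have h3 : ContinuousOn (fun t : ℝ => tangentMapWithin 𝓘(ℝ, ℝ) (𝓡 n) η (Icc a b)
        ((tangentBundleModelSpaceHomeomorph 𝓘(ℝ, ℝ)).symm (t, (1 : ℝ)))) (Icc a b) := by
      refine h2.comp ((Homeomorph.continuous _).comp (by fun_prop)).continuousOn ?_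
      intro t ht
      exact ht
    exact F.continuous_toFun.comp_continuousOn h3
  -- A continuous extension of the speed to the whole line, so that its primitive is differentiable
  -- at the end points as well.
  set L' : ℝ → ℝ := IccExtend hab.le ((Icc a b).domRestrict L) with hL'
  have hL'c : Continuous L' := (continuousOn_iff_continuous_domRestrict.1 hLc).Icc_extend'
  have hL'L : ∀ t ∈ Icc a b, L' t = L t := fun t ht => by
    simp [hL', IccExtend_of_mem _ _ ht, domRestrict]
  -- The function `f ∘ η` need not be differentiable. The comparison principle only asks that the
  -- right slopes of `-f ∘ η` at `t₀` be eventually below every `r > L t₀`, which is what the slope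
  -- bound at `η t₀` provides.
  have hle : ∀ t ∈ Icc a b, -f (η t) ≤ -f (η a) + ∫ s in a..t, L' s := by
    have hB : ∀ t, HasDerivAt (fun t => -f (η a) + ∫ s in a..t, L' s) (L' t) t := fun t =>
      (hL'c.integral_hasStrictDerivAt a t).hasDerivAt.const_add _
    refine image_le_of_liminf_slope_right_le_deriv_boundary
      (hf.continuous.comp_continuousOn hη.continuousOn).neg (by simp)
      (fun t _ => (hB t).continuousAt.continuousWithinAt)
      (fun t _ => (hB t).hasDerivWithinAt) ?_
    intro t₀ ht₀ r hr
    have ht₀' : t₀ ∈ Icc a b := Ico_subset_Icc_self ht₀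
    rw [hL'L t₀ ht₀'] at hr
    set φ := chartAt 𝔼 (η t₀) with hφdef
    have hφ : φ ∈ IsManifold.maximalAtlas (𝓡 n) ∞ M := IsManifold.chart_mem_maximalAtlas _
    have hsrc : η t₀ ∈ φ.source := mem_chart_source 𝔼 _
    have hmd := mdifferentiable_of_mem_maximalAtlas hφ
    have hη' : HasMFDerivWithinAt 𝓘(ℝ, ℝ) (𝓡 n) η (Icc a b) t₀
        (mfderivWithin 𝓘(ℝ, ℝ) (𝓡 n) η (Icc a b) t₀) :=
      ((hη t₀ ht₀').mdifferentiableWithinAt one_ne_zero).hasMFDerivWithinAt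
    have hφ' := (hmd.mdifferentiableAt hsrc).hasMFDerivAt
    obtain ⟨A, hA, hA1⟩ : ∃ A : ℝ →L[ℝ] 𝔼, HasFDerivWithinAt (φ ∘ η) A (Icc a b) t₀ ∧
        A 1 = (mfderiv (𝓡 n) 𝓘(ℝ, 𝔼) φ (η t₀))
          (mfderivWithin 𝓘(ℝ, ℝ) (𝓡 n) η (Icc a b) t₀ (1 : ℝ)) :=
      ⟨_, (hφ'.comp_hasMFDerivWithinAt t₀ hη').hasFDerivWithinAt, rfl⟩
    set γ : ℝ → 𝔼 := φ ∘ η with hγ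
    set γ' : 𝔼 := (mfderiv (𝓡 n) 𝓘(ℝ, 𝔼) φ (η t₀))
      (mfderivWithin 𝓘(ℝ, ℝ) (𝓡 n) η (Icc a b) t₀ (1 : ℝ)) with hγ'
    have hγd : HasDerivWithinAt γ γ' (Icc a b) t₀ := by
      have h := hA.hasDerivWithinAt
      rwa [hA1] at h
    have hΦ : F.chartNorm φ (γ t₀) γ' = L t₀ := by
      have h1 := congrArg (fun A => A (mfderivWithin 𝓘(ℝ, ℝ) (𝓡 n) η (Icc a b) t₀ (1 : ℝ)))
        (hmd.symm_comp_deriv hsrc)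
      have h2 : φ.symm (φ (η t₀)) = η t₀ := φ.left_inv hsrc
      have h3 : mfderiv 𝓘(ℝ, 𝔼) (𝓡 n) φ.symm (φ (η t₀)) γ'
          = mfderivWithin 𝓘(ℝ, ℝ) (𝓡 n) η (Icc a b) t₀ (1 : ℝ) := h1
      exact (congrArg (fun w : 𝔼 => F.toFun (φ.symm (φ (η t₀))) w) h3).trans
        (F.toFun_congr h2 _)
    obtain ⟨δ, hδ, hδr⟩ : ∃ δ : ℝ, 0 < δ ∧ L t₀ + δ * ‖γ'‖ < r := by
      have h1 : 0 < ‖γ'‖ + 1 := by positivity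
      refine ⟨(r - L t₀) / (2 * (‖γ'‖ + 1)), by
        apply div_pos <;> linarith, ?_⟩
      have h2 : (r - L t₀) / (2 * (‖γ'‖ + 1)) * (‖γ'‖ + 1) = (r - L t₀) / 2 := by
        field_simp
      have h3 : 0 < (r - L t₀) / (2 * (‖γ'‖ + 1)) := by
        apply div_pos <;> linarith
      nlinarith
    have hz₀ : γ t₀ ∈ φ.target := φ.map_source hsrc
    have hle1 : 𝓝[>] t₀ ≤ 𝓝[Icc a b] t₀ := by
      rw [← nhdsWithin_Ioo_eq_nhdsGT ht₀.2]
      exact nhdsWithin_mono _ fun s hs => ⟨ht₀.1.trans hs.1.le, hs.2.le⟩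
    have hle2 : 𝓝[>] t₀ ≤ 𝓝[Icc a b \ {t₀}] t₀ := by
      rw [← nhdsWithin_Ioo_eq_nhdsGT ht₀.2]
      exact nhdsWithin_mono _ fun s hs => ⟨⟨ht₀.1.trans hs.1.le, hs.2.le⟩, hs.1.ne'⟩
    have hq : Tendsto (slope γ t₀) (𝓝[>] t₀) (𝓝 γ') :=
      (hasDerivWithinAt_iff_tendsto_slope.1 hγd).mono_left hle2
    have hΦc : Continuous fun v => F.chartNorm φ (γ t₀) v + δ * ‖v‖ := by
      have : Continuous fun v => F.chartNorm φ (γ t₀) v :=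
        (F.continuousOn_chartNorm hφ).comp_continuous (f := fun v : 𝔼 => (γ t₀, v))
          (by fun_prop) (fun v => ⟨hz₀, mem_univ _⟩)
      fun_prop
    have hlim := ((hΦc.tendsto γ').comp hq).eventually_lt_const (show _ < r by rw [hΦ]; exact hδr)
    have hγt : Tendsto γ (𝓝[>] t₀) (𝓝 (γ t₀)) := hγd.continuousWithinAt.mono_left hle1
    have hslope := (tendsto_const_nhds.prodMk_nhds hγt).eventually (hf φ hφ (γ t₀) hz₀ δ hδ)
    have hηsrc : ∀ᶠ t in 𝓝[>] t₀, η t ∈ φ.source :=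
      (((hη.continuousOn t₀ ht₀').mono_left hle1)).eventually (φ.open_source.mem_nhds hsrc)
    refine Eventually.frequently ?_
    filter_upwards [hlim, hslope, hηsrc, self_mem_nhdsWithin] with t h1 h2 h3 h4
    have ht : 0 < t - t₀ := sub_pos.2 h4
    refine lt_of_le_of_lt ?_ h1
    simp only [Function.comp_apply, slope_def_module, smul_eq_mul]
    simp only [hγ, Function.comp_apply, φ.left_inv hsrc, φ.left_inv h3] at h2 ⊢
    rw [F.chartNorm_smul _ _ (inv_nonneg.2 ht.le), norm_smul, Real.norm_of_nonneg
      (inv_nonneg.2 ht.le)]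
    have : (t - t₀)⁻¹ * (f (η t₀) - f (η t)) ≤ (t - t₀)⁻¹ * (F.chartNorm φ (φ (η t₀))
        (φ (η t) - φ (η t₀)) + δ * ‖φ (η t) - φ (η t₀)‖) :=
      mul_le_mul_of_nonneg_left h2 (inv_nonneg.2 ht.le)
    calc _ = (t - t₀)⁻¹ * (f (η t₀) - f (η t)) := by
          simp only [Pi.neg_apply, Function.comp_apply]; ring
      _ ≤ _ := this
      _ = _ := by ring
  have h1 := hle b (right_mem_Icc.2 hab.le)
  have h2 : f (η a) - f (η b) ≤ ∫ s in Ioc a b, L' s := by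
    rw [intervalIntegral.integral_of_le hab.le] at h1
    linarith
  have hL'0 : ∀ t, 0 ≤ L' t := fun t => F.nonneg _ _
  calc ENNReal.ofReal (f (η a) - f (η b)) ≤ ENNReal.ofReal (∫ s in Ioc a b, L' s) :=
        ENNReal.ofReal_le_ofReal h2
    _ = ∫⁻ s in Ioc a b, ENNReal.ofReal (L' s) :=
        ofReal_integral_eq_lintegral_ofReal
          (hL'c.integrableOn_Icc.mono_set Ioc_subset_Icc_self) (Eventually.of_forall hL'0)
    -- The length is defined with `mfderiv`, which is known to agree with the one-sided derivative
    -- only in the interior.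
    _ = ∫⁻ s in Ioo a b, ENNReal.ofReal (L' s) := setLIntegral_congr Ioo_ae_eq_Ioc.symm
    _ = ∫⁻ t in Ioo a b,
      ENNReal.ofReal (F.toFun (η t) (mfderiv 𝓘(ℝ, ℝ) (𝓡 n) η t (1 : ℝ))) := by
        refine setLIntegral_congr_fun measurableSet_Ioo fun t ht => ?_
        have h3 : mfderivWithin 𝓘(ℝ, ℝ) (𝓡 n) η (Icc a b) t = mfderiv 𝓘(ℝ, ℝ) (𝓡 n) η t :=
          mfderivWithin_of_mem_nhds (Icc_mem_nhds ht.1 ht.2)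
        simp only [hL'L t (Ioo_subset_Icc_self ht), hL]
        rw [h3]
    _ ≤ _ := lintegral_mono_set Ioo_subset_Icc_self

theorem ofReal_sub_le_dist (hf : F.HasSlopeBound f) (x y : M) :
    ENNReal.ofReal (f x - f y) ≤ F.dist x y := by
  refine le_iInf₂ fun η hη => ?_
  obtain ⟨⟨-, k, t, htm, ht0, htk, hC⟩, rfl, rfl⟩ := hη
  have key : ∀ i ≤ k, ENNReal.ofReal (f (η 0) - f (η (t i))) ≤ ∫⁻ s in Ioc 0 (t i),
      ENNReal.ofReal (F.toFun (η s) (mfderiv 𝓘(ℝ, ℝ) (𝓡 n) η s (1 : ℝ))) := by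
    intro i
    induction i with
    | zero => intro _; simp [ht0]
    | succ i ih =>
      intro hi
      have h1 := ih (by omega)
      have h2 := hf.ofReal_sub_le_lintegral (htm (Nat.le_succ i)) (hC i (by omega))
      rw [setLIntegral_congr Ioc_ae_eq_Icc.symm] at h2
      have h3 : Ioc 0 (t (i + 1)) = Ioc 0 (t i) ∪ Ioc (t i) (t (i + 1)) :=
        (Ioc_union_Ioc_eq_Ioc (ht0 ▸ htm (Nat.zero_le i)) (htm (Nat.le_succ i))).symm
      rw [h3, lintegral_union measurableSet_Ioc (Ioc_disjoint_Ioc_of_le le_rfl)]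
      refine le_trans ?_ (add_le_add h1 h2)
      refine le_trans (ENNReal.ofReal_le_ofReal ?_) ENNReal.ofReal_add_le
      simp
  have h := key k le_rfl
  rw [htk, setLIntegral_congr Ioc_ae_eq_Icc] at h
  exact h

end HasSlopeBound

/-! ### Reparametrisation, concatenation of curves and chart segments -/

/-- No differentiability is needed: the affine change of parameter is invertible, so both
derivatives take the default value `0` together. -/
theorem mfderiv_comp_affine (η : ℝ → M) {c : ℝ} (hc : c ≠ 0) (d t : ℝ) :
    (mfderiv 𝓘(ℝ, ℝ) (𝓡 n) (fun s => η (c * s + d)) t (1 : ℝ) : 𝔼) =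
      c • (mfderiv 𝓘(ℝ, ℝ) (𝓡 n) η (c * t + d) (1 : ℝ) : 𝔼) := by
  have ha : ∀ s : ℝ, HasMFDerivAt 𝓘(ℝ, ℝ) 𝓘(ℝ, ℝ) (fun s : ℝ => c * s + d) s
      (ContinuousLinearMap.toSpanSingleton ℝ c : ℝ →L[ℝ] ℝ) := fun s => by
    have : HasDerivAt (fun s : ℝ => c * s + d) c s := by
      simpa using ((hasDerivAt_id s).const_mul c).add_const d
    exact this.hasFDerivAt.hasMFDerivAt
  by_cases h : MDifferentiableAt 𝓘(ℝ, ℝ) (𝓡 n) η (c * t + d)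
  · have h1 := h.hasMFDerivAt.comp t (ha t)
    have h2 := h1.mfderiv
    have h3 : (mfderiv 𝓘(ℝ, ℝ) (𝓡 n) (fun s => η (c * s + d)) t (1 : ℝ) : 𝔼) =
      mfderiv 𝓘(ℝ, ℝ) (𝓡 n) η (c * t + d) ((1 : ℝ) • c) := by
      have := congrArg (fun A : ℝ →L[ℝ] 𝔼 => A 1) h2
      exact this
    have h4 : (1 : ℝ) • c = c • (1 : ℝ) := by simp
    rw [h3, h4]
    exact (mfderiv 𝓘(ℝ, ℝ) (𝓡 n) η (c * t + d)).map_smul c (1 : ℝ)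
  · have h' : ¬ MDifferentiableAt 𝓘(ℝ, ℝ) (𝓡 n) (fun s => η (c * s + d)) t := by
      intro h0
      apply h
      have hb : MDifferentiableAt 𝓘(ℝ, ℝ) 𝓘(ℝ, ℝ) (fun s : ℝ => c⁻¹ * s + -(c⁻¹ * d))
          (c * t + d) := by
        apply DifferentiableAt.mdifferentiableAt
        fun_prop
      have ht : c⁻¹ * (c * t + d) + -(c⁻¹ * d) = t := by field_simp; ring
      have h1 := MDifferentiableAt.comp (g := fun s => η (c * s + d)) (c * t + d)
        (by rw [ht]; exact h0) hb
      refine h1.congr_of_eventuallyEq (Eventually.of_forall fun s => ?_)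
      simp only [Function.comp]
      congr 1
      field_simp
      ring
    rw [mfderiv_zero_of_not_mdifferentiableAt h, mfderiv_zero_of_not_mdifferentiableAt h']
    exact (smul_zero c).symm

theorem lintegral_comp_affine (η : ℝ → M) {c : ℝ} (hc : 0 < c) (a b d : ℝ) :
    ∫⁻ t in Ioo a b, ENNReal.ofReal (F.toFun (η (c * t + d))
        (mfderiv 𝓘(ℝ, ℝ) (𝓡 n) (fun s => η (c * s + d)) t (1 : ℝ))) =
      ∫⁻ t in Ioo (c * a + d) (c * b + d), ENNReal.ofReal (F.toFun (η t)
        (mfderiv 𝓘(ℝ, ℝ) (𝓡 n) η t (1 : ℝ))) := by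
  have himg : (fun s : ℝ => c * s + d) '' Ioo a b = Ioo (c * a + d) (c * b + d) := by
    ext s
    simp only [mem_image, mem_Ioo]
    constructor
    · rintro ⟨x, ⟨h1, h2⟩, rfl⟩
      constructor <;> gcongr
    · rintro ⟨h1, h2⟩
      refine ⟨(s - d) / c, ⟨?_, ?_⟩, by field_simp; ring⟩
      · rw [lt_div_iff₀ hc]; linarith
      · rw [div_lt_iff₀ hc]; linarith
  rw [← himg, lintegral_image_eq_lintegral_abs_deriv_mul measurableSet_Ioo (f' := fun _ => c)
    (fun x _ => by
      simpa using (((hasDerivAt_id x).const_mul c).add_const d).hasDerivWithinAt)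
    (fun x _ y _ hxy => by simpa [hc.ne'] using hxy)]
  refine setLIntegral_congr_fun measurableSet_Ioo fun t _ => ?_
  rw [abs_of_pos hc, ← ENNReal.ofReal_mul hc.le]
  congr 1
  refine (congrArg (fun w : 𝔼 => F.toFun (η (c * t + d)) w)
    (mfderiv_comp_affine η hc.ne' d t)).trans ?_
  exact F.homogeneous _ _ _ hc.le

/-- The derivative is local. The interval is open because the curves may separate beyond its end
points, changing `mfderiv` there. -/
theorem setLIntegral_congr_curve {η η' : ℝ → M} {a b : ℝ} (h : EqOn η η' (Ioo a b)) :
    ∫⁻ t in Ioo a b, ENNReal.ofReal (F.toFun (η t) (mfderiv 𝓘(ℝ, ℝ) (𝓡 n) η t (1 : ℝ))) =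
      ∫⁻ t in Ioo a b, ENNReal.ofReal (F.toFun (η' t)
        (mfderiv 𝓘(ℝ, ℝ) (𝓡 n) η' t (1 : ℝ))) := by
  refine setLIntegral_congr_fun measurableSet_Ioo fun t ht => ?_
  have h1 : η =ᶠ[𝓝 t] η' := h.eventuallyEq_of_mem (Ioo_mem_nhds ht.1 ht.2)
  have h2 : (mfderiv 𝓘(ℝ, ℝ) (𝓡 n) η t (1 : ℝ) : 𝔼) = mfderiv 𝓘(ℝ, ℝ) (𝓡 n) η' t (1 : ℝ) :=
    congrArg (fun A : ℝ →L[ℝ] 𝔼 => A 1) h1.mfderiv_eq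
  congr 1
  exact (congrArg (fun w : 𝔼 => F.toFun (η t) w) h2).trans (F.toFun_congr (h ht) _)

/-- Two curves are run one after the other at double speed; homogeneity makes lengths invariant
under this reparametrisation. -/
theorem dist_triangle (x y z : M) : F.dist x z ≤ F.dist x y + F.dist y z := by
  unfold FinslerStructure.dist
  simp only [ENNReal.iInf_add, ENNReal.add_iInf]
  refine le_iInf₂ fun η₂ h₂ => le_iInf₂ fun η₁ h₁ => ?_
  obtain ⟨⟨hc₁, k₁, t₁, hm₁, h0₁, hk₁, hC₁⟩, rfl, rfl⟩ := h₁
  obtain ⟨⟨hc₂, k₂, t₂, hm₂, h0₂, hk₂, hC₂⟩, h12, rfl⟩ := h₂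
  set η : ℝ → M := fun t => if t ≤ 1 / 2 then η₁ (2 * t + 0) else η₂ (2 * t + -1) with hη
  have he₁ : ∀ t, t ≤ 1 / 2 → η t = η₁ (2 * t + 0) := fun t ht => if_pos ht
  have he₂ : ∀ t, 1 / 2 ≤ t → η t = η₂ (2 * t + -1) := fun t ht => by
    rcases ht.eq_or_lt with rfl | ht
    · rw [he₁ _ le_rfl]
      norm_num
      exact h12.symm
    · exact if_neg (not_le.2 ht)
  have haff : ∀ d : ℝ, ContMDiff 𝓘(ℝ, ℝ) 𝓘(ℝ, ℝ) 1 fun t : ℝ => 2 * t + d := fun d =>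
    ContDiff.contMDiff (by fun_prop)
  have hlen : F.length η ≤ F.length η₁ + F.length η₂ := by
    unfold FinslerStructure.length
    rw [setLIntegral_congr (Ioc_ae_eq_Icc (α := ℝ)).symm,
      ← Ioc_union_Ioc_eq_Ioc (show (0 : ℝ) ≤ 1 / 2 by norm_num) (show (1 / 2 : ℝ) ≤ 1 by norm_num),
      lintegral_union measurableSet_Ioc (Ioc_disjoint_Ioc_of_le le_rfl),
      setLIntegral_congr (Ioo_ae_eq_Ioc (a := (0 : ℝ))).symm,
      setLIntegral_congr (Ioo_ae_eq_Ioc (a := (1 / 2 : ℝ))).symm,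
      F.setLIntegral_congr_curve (fun t ht => he₁ t ht.2.le),
      F.setLIntegral_congr_curve (fun t ht => he₂ t ht.1.le),
      F.lintegral_comp_affine η₁ two_pos, F.lintegral_comp_affine η₂ two_pos]
    norm_num
    exact add_le_add (lintegral_mono_set Ioo_subset_Icc_self)
      (lintegral_mono_set Ioo_subset_Icc_self)
  -- The subdivision consists of the halved break points of `η₁`, then those of `η₂` shifted by `1 /
  -- 2`; index `k₁` is the junction, where both formulas give `1 / 2`.
  refine le_trans (iInf₂_le η ⟨⟨?_, k₁ + k₂,
    fun i => if i ≤ k₁ then t₁ i / 2 else 1 / 2 + t₂ (i - k₁) / 2, ?_, ?_, ?_, ?_⟩, ?_, ?_⟩) hlen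
  · rw [← Icc_union_Icc_eq_Icc (show (0 : ℝ) ≤ 1 / 2 by norm_num)
      (show (1 / 2 : ℝ) ≤ 1 by norm_num)]
    refine ContinuousOn.union_of_isClosed ?_ ?_ isClosed_Icc isClosed_Icc
    · have : ContinuousOn (fun t : ℝ => η₁ (2 * t + 0)) (Icc 0 (1 / 2)) :=
        hc₁.comp (by fun_prop) fun t ht => ⟨by linarith [ht.1], by linarith [ht.2]⟩
      exact this.congr fun t ht => he₁ t ht.2
    · have : ContinuousOn (fun t : ℝ => η₂ (2 * t + -1)) (Icc (1 / 2) 1) :=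
        hc₂.comp (by fun_prop) fun t ht => ⟨by linarith [ht.1], by linarith [ht.2]⟩
      exact this.congr fun t ht => he₂ t ht.1
  · refine monotone_nat_of_le_succ fun i => ?_
    rcases lt_trichotomy i k₁ with h | h | h
    · simp only [show i ≤ k₁ from h.le, show i + 1 ≤ k₁ from h, if_true]
      linarith [hm₁ (Nat.le_succ i)]
    · subst h
      have := hm₂ (Nat.zero_le 1)
      simp only [le_refl, if_true, show ¬ (i + 1 ≤ i) by omega, if_false,
        show i + 1 - i = 1 by omega]
      linarith
    · simp only [show ¬ i ≤ k₁ by omega, show ¬ i + 1 ≤ k₁ by omega, if_false,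
        show i + 1 - k₁ = (i - k₁) + 1 by omega]
      linarith [hm₂ (Nat.le_succ (i - k₁))]
  · simp [h0₁]
  · rcases Nat.eq_zero_or_pos k₂ with h | h
    · subst h
      linarith
    · simp only [show ¬ (k₁ + k₂ ≤ k₁) by omega, if_false, show k₁ + k₂ - k₁ = k₂ by omega, hk₂]
      norm_num
  · intro i hi
    rcases lt_or_ge i k₁ with h | h
    · simp only [show i ≤ k₁ from h.le, show i + 1 ≤ k₁ from h, if_true]
      have h1 : t₁ (i + 1) ≤ 1 := hk₁ ▸ hm₁ h
      refine ((hC₁ i h).comp (haff 0).contMDiffOn fun t ht => ?_).congr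
        fun t ht => he₁ t (by linarith [ht.2])
      exact ⟨by linarith [ht.1], by linarith [ht.2]⟩
    · obtain ⟨j, rfl⟩ := Nat.exists_eq_add_of_le h
      have h1 : (if k₁ + j ≤ k₁ then t₁ (k₁ + j) / 2 else 1 / 2 + t₂ (k₁ + j - k₁) / 2) =
          1 / 2 + t₂ j / 2 := by
        rcases Nat.eq_zero_or_pos j with h | h
        · subst h
          simp [hk₁, h0₂]
        · simp [show j ≠ 0 by omega]
      have h2 : 0 ≤ t₂ j := h0₂ ▸ hm₂ (Nat.zero_le j)
      simp only [h1, show ¬ (k₁ + j + 1 ≤ k₁) by omega, if_false,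
        show k₁ + j + 1 - k₁ = j + 1 by omega]
      refine ((hC₂ j (by omega)).comp (haff (-1)).contMDiffOn fun t ht => ?_).congr
        fun t ht => he₂ t (by linarith [ht.1])
      exact ⟨by linarith [ht.1], by linarith [ht.2]⟩
  · rw [he₁ 0 (by norm_num)]
    norm_num
  · rw [he₂ 1 (by norm_num)]
    norm_num

theorem dist_chart_symm_le (hφ : φ ∈ IsManifold.maximalAtlas (𝓡 n) ∞ M) {x y : 𝔼}
    (hxy : ∀ t ∈ Icc (0 : ℝ) 1, x + t • (y - x) ∈ φ.target) :
    F.dist (φ.symm x) (φ.symm y) ≤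
      ∫⁻ t in Icc (0 : ℝ) 1, ENNReal.ofReal (F.chartNorm φ (x + t • (y - x)) (y - x)) := by
  set η : ℝ → M := fun t => φ.symm (x + t • (y - x)) with hη
  have hseg : ContMDiff 𝓘(ℝ, ℝ) 𝓘(ℝ, 𝔼) 1 fun t : ℝ => x + t • (y - x) :=
    ContDiff.contMDiff (by fun_prop)
  have hC : ContMDiffOn 𝓘(ℝ, ℝ) (𝓡 n) 1 η (Icc 0 1) :=
    ((contMDiffOn_symm_of_mem_maximalAtlas hφ).of_le (by simp)).comp hseg.contMDiffOn hxy
  refine (iInf₂_le η ⟨⟨hC.continuousOn, 1, fun i => i, Nat.mono_cast, by simp, by simp, ?_⟩,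
    by simp [hη], by simp [hη]⟩).trans (le_of_eq ?_)
  swap
  · intro i hi
    obtain rfl : i = 0 := by omega
    simpa using hC
  · refine setLIntegral_congr_fun measurableSet_Icc fun t ht => ?_
    have h1 : MDifferentiableAt 𝓘(ℝ, 𝔼) (𝓡 n) φ.symm (x + t • (y - x)) :=
      (mdifferentiable_of_mem_maximalAtlas hφ).mdifferentiableAt_symm (hxy t ht)
    have h2 : HasMFDerivAt 𝓘(ℝ, ℝ) 𝓘(ℝ, 𝔼) (fun t : ℝ => x + t • (y - x)) t
        (ContinuousLinearMap.toSpanSingleton ℝ (y - x) : ℝ →L[ℝ] 𝔼) := by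
      have : HasDerivAt (fun t : ℝ => x + t • (y - x)) (y - x) t := by
        simpa using ((hasDerivAt_id t).smul_const (y - x)).const_add x
      exact this.hasFDerivAt.hasMFDerivAt
    have h3 := (h1.hasMFDerivAt.comp t h2).mfderiv
    have h4 : (mfderiv 𝓘(ℝ, ℝ) (𝓡 n) η t (1 : ℝ) : 𝔼) =
        mfderiv 𝓘(ℝ, 𝔼) (𝓡 n) φ.symm (x + t • (y - x)) ((1 : ℝ) • (y - x)) :=
      congrArg (fun A : ℝ →L[ℝ] 𝔼 => A 1) h3
    rw [one_smul] at h4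
    congr 1
    exact congrArg (fun w : 𝔼 => F.toFun (η t) w) h4

/-- The straight chart segment is a competitor for the distance, and in a small ball its speed
differs from the frozen norm by at most `δ‖·‖`. -/
theorem eventually_dist_chart_symm_le (hφ : φ ∈ IsManifold.maximalAtlas (𝓡 n) ∞ M) {z₀ : 𝔼}
    (hz₀ : z₀ ∈ φ.target) {δ : ℝ} (hδ : 0 < δ) :
    ∀ᶠ p : 𝔼 × 𝔼 in 𝓝 (z₀, z₀), F.dist (φ.symm p.1) (φ.symm p.2) ≤
      ENNReal.ofReal (F.chartNorm φ z₀ (p.2 - p.1) + δ * ‖p.2 - p.1‖) := by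
  have h1 := (F.eventually_abs_chartNorm_sub_le hφ hz₀ hδ).and (φ.open_target.mem_nhds hz₀)
  obtain ⟨r, hr, h⟩ := Metric.eventually_nhds_iff_ball.1 h1
  refine Metric.eventually_nhds_iff_ball.2 ⟨r, hr, ?_⟩
  rw [← ball_prod_same]
  rintro ⟨x, y⟩ ⟨hx, hy⟩
  have hseg : ∀ t ∈ Icc (0 : ℝ) 1, x + t • (y - x) ∈ Metric.ball z₀ r := fun t ht =>
    (convex_ball z₀ r).add_smul_sub_mem hx hy ht
  refine (F.dist_chart_symm_le hφ fun t ht => (h _ (hseg t ht)).2).trans ?_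
  calc _ ≤ ∫⁻ t in Icc (0 : ℝ) 1,
        ENNReal.ofReal (F.chartNorm φ z₀ (y - x) + δ * ‖y - x‖) := by
        refine setLIntegral_mono' measurableSet_Icc fun t ht => ENNReal.ofReal_le_ofReal ?_
        have := (abs_le.1 ((h _ (hseg t ht)).1 (y - x))).2
        linarith
    _ = _ := by simp

theorem hasSlopeBound_of_ofReal_sub_le {f : M → ℝ}
    (hf : ∀ x y, ENNReal.ofReal (f x - f y) ≤ F.dist x y) : F.HasSlopeBound f := by
  intro φ hφ z₀ hz₀ δ hδ
  filter_upwards [F.eventually_dist_chart_symm_le hφ hz₀ hδ] with p hp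
  have h1 := (hf (φ.symm p.1) (φ.symm p.2)).trans hp
  exact (ENNReal.ofReal_le_ofReal_iff (add_nonneg (F.chartNorm_nonneg _ _) (by positivity))).1 h1

end FinslerStructure

/-! ### Weak derivatives of locally Lipschitz functions -/

section LocallyLipschitz

variable {U : Set (EuclideanSpace ℝ (Fin n))} {u : EuclideanSpace ℝ (Fin n) → ℝ}

theorem ae_differentiableAt_of_locallyLipschitz (hu : ∀ z ∈ U, ∃ C : NNReal, ∃ r : ℝ, 0 < r ∧
    LipschitzOnWith C u (Metric.ball z r)) :
    ∀ᵐ y : 𝔼, y ∈ U → DifferentiableAt ℝ u y := by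
  have : volume {y | y ∈ U ∧ ¬ DifferentiableAt ℝ u y} = 0 := by
    refine measure_null_of_locally_null _ fun z hz => ?_
    obtain ⟨C, r, hr, hl⟩ := hu z hz.1
    refine ⟨{y | y ∈ U ∧ ¬ DifferentiableAt ℝ u y} ∩ Metric.ball z r,
      inter_mem_nhdsWithin _ (Metric.ball_mem_nhds z hr), ?_⟩
    refine measure_mono_null ?_ (ae_iff.1 (hl.ae_differentiableWithinAt_of_mem (μ := volume)))
    rintro y ⟨⟨-, hn⟩, hy⟩ h
    exact hn ((h hy).differentiableAt (Metric.isOpen_ball.mem_nhds hy))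
  rw [ae_iff]
  simpa using this

theorem memL2Loc_fderiv_of_locallyLipschitz (hu : ∀ z ∈ U, ∃ C : NNReal, ∃ r : ℝ, 0 < r ∧
    LipschitzOnWith C u (Metric.ball z r)) : MemL2Loc U (fderiv ℝ u) := by
  intro K hKU hK
  have hb : ∃ C : ℝ, ∀ y ∈ K, ‖fderiv ℝ u y‖ ≤ C := by
    refine hK.induction_on (p := fun s => ∃ C : ℝ, ∀ y ∈ s, ‖fderiv ℝ u y‖ ≤ C) ⟨0, by simp⟩
      (fun s t hst ⟨C, hC⟩ => ⟨C, fun y hy => hC y (hst hy)⟩)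
      (fun s t ⟨C, hC⟩ ⟨D, hD⟩ => ⟨max C D, fun y hy => hy.elim
        (fun h => (hC y h).trans (le_max_left _ _)) fun h => (hD y h).trans (le_max_right _ _)⟩)
      fun z hz => ?_
    obtain ⟨C, r, hr, hl⟩ := hu z (hKU hz)
    exact ⟨Metric.ball z r, mem_nhdsWithin_of_mem_nhds (Metric.ball_mem_nhds z hr), C,
      fun y hy => norm_fderiv_le_of_lipschitzOn ℝ (Metric.isOpen_ball.mem_nhds hy) hl⟩
  obtain ⟨C, hC⟩ := hb
  have : IsFiniteMeasure (volume.restrict K) := ⟨by simpa using hK.measure_lt_top⟩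
  exact MemLp.of_bound (measurable_fderiv ℝ u).aestronglyMeasurable C
    (ae_restrict_of_forall_mem hK.measurableSet hC)

theorem memL2Loc_of_continuousOn (hu : ContinuousOn u U) : MemL2Loc U u := by
  intro K hKU hK
  have : IsFiniteMeasure (volume.restrict K) := ⟨by simpa using hK.measure_lt_top⟩
  obtain ⟨C, hC⟩ := hK.exists_bound_of_continuousOn (hu.mono hKU)
  exact MemLp.of_bound ((hu.mono hKU).aestronglyMeasurable hK.measurableSet) C
    (ae_restrict_of_forall_mem hK.measurableSet hC)

/-- On the compact support of a test function `u` is genuinely Lipschitz, so it extends to a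
globally Lipschitz `g`, for which integration by parts is available. -/
theorem isWeakDerivOn_fderiv_of_locallyLipschitz (hu : ∀ z ∈ U, ∃ C : NNReal, ∃ r : ℝ, 0 < r ∧
    LipschitzOnWith C u (Metric.ball z r)) : IsWeakDerivOn U u (fderiv ℝ u) := by
  intro ψ hψ hψc hψU v
  have hloc : LocallyLipschitzOn (tsupport ψ) u := fun z hz => by
    obtain ⟨C, r, hr, hl⟩ := hu z (hψU hz)
    exact ⟨C, _, mem_nhdsWithin_of_mem_nhds (Metric.ball_mem_nhds z hr), hl⟩
  obtain ⟨C, hC⟩ := hloc.exists_lipschitzOnWith_of_compact hψc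
  obtain ⟨g, hg, hgu⟩ := hC.extend_real
  obtain ⟨D, hD⟩ := (hψ.of_le (m := 1) (by simp)).lipschitzWith_of_hasCompactSupport hψc one_ne_zero
  have h0 : ∀ y, y ∉ tsupport ψ → fderiv ℝ ψ y = 0 := fun y hy =>
    image_eq_zero_of_notMem_tsupport fun h => hy (tsupport_fderiv_subset ℝ h)
  have key := LipschitzWith.integral_lineDeriv_mul_eq (μ := (volume : Measure 𝔼)) hg hD hψc v
  have h1 : ∫ y, u y * fderiv ℝ ψ y v = -∫ y, lineDeriv ℝ ψ y (-v) * g y := by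
    rw [← integral_neg]
    refine integral_congr_ae (Eventually.of_forall fun y => ?_)
    have hd : lineDeriv ℝ ψ y (-v) = fderiv ℝ ψ y (-v) :=
      ((hψ.differentiable (by simp)) y).lineDeriv_eq_fderiv
    simp only
    rw [hd]
    by_cases hy : y ∈ tsupport ψ
    · rw [hgu hy]
      simp [mul_comm]
    · simp [h0 y hy]
  rw [h1, ← key]
  congr 1
  refine integral_congr_ae ?_
  filter_upwards [ae_differentiableAt_of_locallyLipschitz hu] with y hy
  by_cases h : ψ y = 0
  · simp [h]
  congr 1
  have hys : y ∈ tsupport ψ := subset_tsupport _ h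
  -- The functions `g` and `u` agree only on `tsupport ψ`, but this is a neighbourhood of any point
  -- with `ψ ≠ 0`; elsewhere the integrand vanishes.
  have heq : g =ᶠ[𝓝 y] u := by
    have : ∀ᶠ z in 𝓝 y, ψ z ≠ 0 := hψ.continuous.continuousAt.eventually_ne h
    filter_upwards [this] with z hz
    exact (hgu (subset_tsupport _ hz)).symm
  rw [heq.lineDeriv_eq]
  exact (hy (hψU hys)).lineDeriv_eq_fderiv

end LocallyLipschitz

/-! ### Null sets of a smooth positive measure in charts -/

section SmoothMeasure

variable [MeasurableSpace M] [BorelSpace M] {m : Measure M}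
  {φ : OpenPartialHomeomorph M (EuclideanSpace ℝ (Fin n))} {p : M → Prop}

theorem measurableSet_image_of_subset_source {s : Set M} (hs : MeasurableSet s)
    (hsφ : s ⊆ φ.source) : MeasurableSet (φ '' s) := by
  rw [φ.image_eq_target_inter_inv_preimage hsφ]
  have h1 : Measurable (φ.target.domRestrict φ.symm) :=
    (continuousOn_iff_continuous_domRestrict.1 φ.continuousOn_symm).measurable
  have h2 := φ.open_target.measurableSet.subtype_image (h1 hs)
  convert h2 using 1
  ext y
  simp [and_comm]

theorem measurableSet_source_inter_preimage {s : Set 𝔼} (hs : MeasurableSet s) :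
    MeasurableSet (φ.source ∩ φ ⁻¹' s) := by
  have h1 : Measurable (φ.source.domRestrict φ) :=
    (continuousOn_iff_continuous_domRestrict.1 φ.continuousOn).measurable
  have h2 := φ.open_source.measurableSet.subtype_image (h1 hs)
  convert h2 using 1
  ext y
  simp [and_comm]

namespace IsSmoothPositiveMeasure

/-- A positive density makes the integral over a set vanish only when the set is Lebesgue null. This
is the only link between `m` and charts used below. -/
theorem measure_eq_zero_iff (hm : IsSmoothPositiveMeasure n m)
    (hφ : φ ∈ IsManifold.maximalAtlas (𝓡 n) ∞ M) {s : Set M} (hs : MeasurableSet s)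
    (hsφ : s ⊆ φ.source) : m s = 0 ↔ volume (φ '' s) = 0 := by
  obtain ⟨ρ, hρ, hρpos, hms⟩ := hm φ hφ
  have hmeas := measurableSet_image_of_subset_source hs hsφ
  have hsub : φ '' s ⊆ φ.target := by
    rintro _ ⟨x, hx, rfl⟩
    exact φ.map_source (hsφ hx)
  rw [hms s hsφ hs]
  constructor
  · intro h
    have hae : AEMeasurable (fun y => ENNReal.ofReal (ρ y)) (volume.restrict (φ '' s)) :=
      ((hρ.continuousOn.mono hsub).aemeasurable hmeas).ennreal_ofReal
    rw [lintegral_eq_zero_iff' hae, EventuallyEq, ae_restrict_iff' hmeas, ae_iff] at h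
    refine measure_mono_null (fun y hy => ?_) h
    have := hρpos y (hsub hy)
    rw [mem_ofPred_eq, Classical.not_imp]
    exact ⟨hy, by simpa using this⟩
  · intro h
    exact setLIntegral_measure_zero _ _ h

theorem ae_chart (hm : IsSmoothPositiveMeasure n m)
    (hφ : φ ∈ IsManifold.maximalAtlas (𝓡 n) ∞ M) (h : ∀ᵐ x ∂m, p x) :
    ∀ᵐ y : 𝔼, y ∈ φ.target → p (φ.symm y) := by
  obtain ⟨N, hN, hNm, hN0⟩ := exists_measurable_superset_of_null (ae_iff.1 h)
  have h1 := (hm.measure_eq_zero_iff hφ (hNm.inter φ.open_source.measurableSet)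
    inter_subset_right).1 (measure_mono_null inter_subset_left hN0)
  rw [ae_iff]
  refine measure_mono_null (fun y hy => ?_) h1
  simp only [mem_ofPred_eq, Classical.not_imp] at hy
  exact ⟨φ.symm y, ⟨hN hy.2, φ.map_target hy.1⟩, φ.right_inv hy.1⟩

theorem ae_of_ae_chart (hm : IsSmoothPositiveMeasure n m)
    (hφ : φ ∈ IsManifold.maximalAtlas (𝓡 n) ∞ M)
    (h : ∀ᵐ y : 𝔼, y ∈ φ.target → p (φ.symm y)) : ∀ᵐ x ∂m, x ∈ φ.source → p x := by
  obtain ⟨N, hN, hNm, hN0⟩ := exists_measurable_superset_of_null (ae_iff.1 h)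
  have h1 := (hm.measure_eq_zero_iff hφ (measurableSet_source_inter_preimage (φ := φ) hNm)
    inter_subset_left).2 (measure_mono_null (by rintro _ ⟨x, hx, rfl⟩; exact hx.2) hN0)
  rw [ae_iff]
  refine measure_mono_null (fun x hx => ?_) h1
  simp only [mem_ofPred_eq, Classical.not_imp] at hx
  refine ⟨hx.1, hN ?_⟩
  simp only [mem_ofPred_eq, Classical.not_imp, φ.left_inv hx.1]
  exact ⟨φ.map_source hx.1, hx.2⟩

theorem isOpenPosMeasure [IsManifold (𝓡 n) ∞ M] (hm : IsSmoothPositiveMeasure n m) :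
    m.IsOpenPosMeasure := by
  refine ⟨fun V hV ⟨x, hx⟩ h0 => ?_⟩
  set φ := chartAt 𝔼 x
  have hop : IsOpen (V ∩ φ.source) := hV.inter φ.open_source
  have h1 := (hm.measure_eq_zero_iff (IsManifold.chart_mem_maximalAtlas x) hop.measurableSet
    inter_subset_right).1 (measure_mono_null inter_subset_left h0)
  have h2 : IsOpen (φ '' (V ∩ φ.source)) :=
    φ.isOpen_image_of_subset_source hop inter_subset_right
  exact (h2.measure_pos volume ⟨φ x, mem_image_of_mem _ ⟨hx, mem_chart_source 𝔼 x⟩⟩).ne' h1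

end IsSmoothPositiveMeasure

end SmoothMeasure

theorem ae_of_locally_ae {X : Type*} [TopologicalSpace X] [SecondCountableTopology X]
    [MeasurableSpace X] {μ : Measure X} {p : X → Prop}
    (h : ∀ x, ∃ V ∈ 𝓝 x, ∀ᵐ y ∂μ, y ∈ V → p y) : ∀ᵐ x ∂μ, p x := by
  rw [ae_iff]
  refine measure_null_of_locally_null _ fun x _ => ?_
  obtain ⟨V, hV, hp⟩ := h x
  refine ⟨{y | ¬ p y} ∩ V, inter_mem_nhdsWithin _ hV, ?_⟩
  refine measure_mono_null (fun y hy => ?_) (ae_iff.1 hp)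
  simpa [and_comm] using hy

/-! ### From the slope bound to the Sobolev class -/

namespace FinslerStructure

variable [IsManifold (𝓡 n) ∞ M] {F : FinslerStructure n M}
  {φ : OpenPartialHomeomorph M (EuclideanSpace ℝ (Fin n))} {f : M → ℝ}

/-- The differential of `f`, with the junk value `0` where `f` is not differentiable. -/
def differential (f : M → ℝ) : CovectorField n M := fun x => mfderiv (𝓡 n) 𝓘(ℝ, ℝ) f x

/-- Charts preserve differentiability in both directions, so the identity persists where `f` is not
differentiable: both sides are `0`. -/
theorem inChart_differential (hφ : φ ∈ IsManifold.maximalAtlas (𝓡 n) ∞ M) (f : M → ℝ) {y : 𝔼}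
    (hy : y ∈ φ.target) :
    inChart φ (differential f) y = fderiv ℝ (f ∘ φ.symm) y := by
  have hmd := mdifferentiable_of_mem_maximalAtlas hφ
  have h1 := hmd.mdifferentiableAt_symm hy
  by_cases hf : MDifferentiableAt (𝓡 n) 𝓘(ℝ, ℝ) f (φ.symm y)
  · obtain ⟨A, hA, hA'⟩ : ∃ A : 𝔼 →L[ℝ] ℝ, HasFDerivAt (f ∘ φ.symm) A y ∧
        A = inChart φ (differential f) y :=
      ⟨_, (hf.hasMFDerivAt.comp y h1.hasMFDerivAt).hasFDerivAt, rfl⟩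
    rw [← hA', hA.fderiv]
  · have h2 : ¬ DifferentiableAt ℝ (f ∘ φ.symm) y := by
      intro h
      apply hf
      have h3 : MDifferentiableAt 𝓘(ℝ, 𝔼) 𝓘(ℝ, ℝ) (f ∘ φ.symm) (φ (φ.symm y)) := by
        rw [φ.right_inv hy]
        exact h.mdifferentiableAt
      have h4 := h3.comp (φ.symm y) (hmd.mdifferentiableAt (φ.map_target hy))
      refine h4.congr_of_eventuallyEq ?_
      filter_upwards [φ.open_source.mem_nhds (φ.map_target hy)] with z hz
      simp [φ.left_inv hz]
    rw [fderiv_zero_of_not_differentiableAt h2]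
    ext v
    have h3 : ∀ w : 𝔼, differential f (φ.symm y) w = 0 := fun w => by
      unfold differential
      rw [mfderiv_zero_of_not_mdifferentiableAt hf]
      rfl
    exact h3 _

theorem exists_mfderiv_symm_eq (hφ : φ ∈ IsManifold.maximalAtlas (𝓡 n) ∞ M) {z : 𝔼}
    (hz : z ∈ φ.target) (w : 𝔼) :
    ∃ v : 𝔼, (mfderiv 𝓘(ℝ, 𝔼) (𝓡 n) φ.symm z v : 𝔼) = w := by
  have hmd := mdifferentiable_of_mem_maximalAtlas hφ
  set A : 𝔼 →L[ℝ] 𝔼 := mfderiv 𝓘(ℝ, 𝔼) (𝓡 n) φ.symm z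
  set B : 𝔼 →L[ℝ] 𝔼 := mfderiv (𝓡 n) 𝓘(ℝ, 𝔼) φ (φ.symm z)
  have h : ∀ v, B (A v) = v := fun v =>
    congrArg (fun C : 𝔼 →L[ℝ] 𝔼 => C v) (hmd.comp_symm_deriv hz)
  have hinj : Function.Injective (A : 𝔼 →ₗ[ℝ] 𝔼) := fun v v' hv => by
    rw [← h v, ← h v']
    exact congrArg B hv
  exact LinearMap.injective_iff_surjective.1 hinj w

namespace HasSlopeBound

/-- The slope bound is divided by `t → 0⁺`, then `δ → 0`. The limit is one-sided since `F` is only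
positively homogeneous. -/
theorem neg_fderiv_le_chartNorm (hf : F.HasSlopeBound f)
    (hφ : φ ∈ IsManifold.maximalAtlas (𝓡 n) ∞ M) {z : 𝔼} (hz : z ∈ φ.target)
    (hd : DifferentiableAt ℝ (f ∘ φ.symm) z) (v : 𝔼) :
    -fderiv ℝ (f ∘ φ.symm) z v ≤ F.chartNorm φ z v := by
  have key : ∀ δ : ℝ, 0 < δ → -fderiv ℝ (f ∘ φ.symm) z v ≤ F.chartNorm φ z v + δ * ‖v‖ := by
    intro δ hδ
    have h1 : Tendsto (fun t : ℝ => t⁻¹ • ((f ∘ φ.symm) (z + t • v) - (f ∘ φ.symm) z)) (𝓝[>] 0)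
        (𝓝 (fderiv ℝ (f ∘ φ.symm) z v)) :=
      (hd.hasFDerivAt.hasLineDerivAt v).tendsto_slope_zero_right
    have h2 : Tendsto (fun t : ℝ => (z, z + t • v)) (𝓝[>] 0) (𝓝 (z, z)) := by
      have : Continuous fun t : ℝ => (z, z + t • v) := by fun_prop
      have := this.tendsto 0
      simp only [zero_smul, add_zero] at this
      exact this.mono_left nhdsWithin_le_nhds
    refine le_of_tendsto h1.neg ?_
    filter_upwards [h2.eventually (hf φ hφ z hz δ hδ), self_mem_nhdsWithin] with t ht ht0
    have ht0 : 0 < t := ht0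
    simp only [add_sub_cancel_left, norm_smul, Real.norm_of_nonneg ht0.le,
      F.chartNorm_smul _ _ ht0.le] at ht
    simp only [Function.comp, smul_eq_mul]
    rw [← mul_neg, inv_mul_le_iff₀ ht0]
    linarith
  refine le_of_forall_pos_le_add fun ε hε => ?_
  refine (key (ε / (‖v‖ + 1)) (by positivity)).trans ?_
  gcongr
  rw [div_mul_eq_mul_div, div_le_iff₀ (by positivity)]
  gcongr
  linarith

/-- By Rademacher's theorem in charts, the pointwise differential exists a.e., is the weak one, and
satisfies the dual bound wherever it exists. -/
theorem mem_sobolevClass [SecondCountableTopology M] [MeasurableSpace M] [BorelSpace M]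
    {m : Measure M} (hm : IsSmoothPositiveMeasure n m) (hf : F.HasSlopeBound f) {C : ℝ}
    (hC : ∀ x, |f x| ≤ C) : f ∈ F.sobolevClass m := by
  refine ⟨memLp_top_of_bound hf.continuous.aestronglyMeasurable C (Eventually.of_forall hC),
    differential f, fun φ hφ => ?_, ?_⟩
  · have hlip : ∀ z ∈ φ.target, ∃ C : NNReal, ∃ r : ℝ, 0 < r ∧
        LipschitzOnWith C (f ∘ φ.symm) (Metric.ball z r) := fun z hz => by
      obtain ⟨C, r, hr, -, hl⟩ := hf.exists_lipschitzOnWith hφ hz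
      exact ⟨C, r, hr, hl⟩
    refine ⟨memL2Loc_of_continuousOn (hf.continuous.comp_continuousOn φ.continuousOn_symm), ?_, ?_⟩
    · intro K hKU hK
      refine (memL2Loc_fderiv_of_locallyLipschitz hlip K hKU hK).ae_eq ?_
      exact ae_restrict_of_forall_mem hK.measurableSet fun y hy =>
        (inChart_differential hφ f (hKU hy)).symm
    · intro ψ hψ hψc hψU v
      rw [isWeakDerivOn_fderiv_of_locallyLipschitz hlip ψ hψ hψc hψU v]
      congr 1
      refine integral_congr_ae (Eventually.of_forall fun y => ?_)
      by_cases hy : y ∈ tsupport ψ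
      · simp only [inChart_differential hφ f (hψU hy)]
      · simp [image_eq_zero_of_notMem_tsupport hy]
  · refine ae_of_locally_ae fun x₀ => ?_
    set φ := chartAt 𝔼 x₀
    have hφ : φ ∈ IsManifold.maximalAtlas (𝓡 n) ∞ M := IsManifold.chart_mem_maximalAtlas x₀
    refine ⟨φ.source, chart_source_mem_nhds 𝔼 x₀, ?_⟩
    refine hm.ae_of_ae_chart hφ ?_
    have hlip : ∀ z ∈ φ.target, ∃ C : NNReal, ∃ r : ℝ, 0 < r ∧
        LipschitzOnWith C (f ∘ φ.symm) (Metric.ball z r) := fun z hz => by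
      obtain ⟨C, r, hr, -, hl⟩ := hf.exists_lipschitzOnWith hφ hz
      exact ⟨C, r, hr, hl⟩
    filter_upwards [ae_differentiableAt_of_locallyLipschitz hlip] with z hd hz
    refine F.dual_le_one_of_le fun w => ?_
    obtain ⟨v, rfl⟩ := exists_mfderiv_symm_eq hφ hz w
    have h1 := hf.neg_fderiv_le_chartNorm hφ hz (hd hz) v
    rw [← inChart_differential hφ f hz] at h1
    exact h1

end HasSlopeBound

end FinslerStructure

/-! ### Mollification of functions with a one-sided bound on the weak derivative -/

section Mollification

variable {U : Set (EuclideanSpace ℝ (Fin n))} {u : EuclideanSpace ℝ (Fin n) → ℝ}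
  {G : EuclideanSpace ℝ (Fin n) → (EuclideanSpace ℝ (Fin n) →L[ℝ] ℝ)}

theorem MemL2Loc.integrableOn {V : Type*} [NormedAddCommGroup V]
    {w : EuclideanSpace ℝ (Fin n) → V} (hw : MemL2Loc U w) {K : Set 𝔼} (hKU : K ⊆ U)
    (hK : IsCompact K) : IntegrableOn w K := by
  have : IsFiniteMeasure (volume.restrict K) := ⟨by simpa using hK.measure_lt_top⟩
  exact (hw K hKU hK).integrable (by norm_num)

/-- A directional bound on the weak derivative passes to the mollified function. -/
theorem neg_fderiv_convolution_le (hG : MemL2Loc U G) (hw : IsWeakDerivOn U u G)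
    {K : Set 𝔼} (hK : IsCompact K) (hKU : K ⊆ U) (hu : IntegrableOn u K)
    (b : ContDiffBump (0 : 𝔼)) {x : 𝔼} (hx : Metric.closedBall x b.rOut ⊆ K) {v : 𝔼} {c : ℝ}
    (hc : ∀ᵐ z : 𝔼, z ∈ K → -G z v ≤ c) :
    ∃ A : 𝔼 →L[ℝ] ℝ, HasFDerivAt
      (convolution (b.normed volume) (K.indicator u) (ContinuousLinearMap.lsmul ℝ ℝ) volume) A x ∧
        -A v ≤ c := by
  set ρ : 𝔼 → ℝ := b.normed volume with hρ
  have hρs : ContDiff ℝ ∞ ρ := b.contDiff_normed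
  have hρc : HasCompactSupport ρ := b.hasCompactSupport_normed
  have hu' : Integrable (K.indicator u) := (integrable_indicator_iff hK.measurableSet).2 hu
  refine ⟨_, hρc.hasFDerivAt_convolution_left (ContinuousLinearMap.lsmul ℝ ℝ)
    (hρs.of_le (by simp)) hu'.locallyIntegrable x, ?_⟩
  -- The mollifier centred at `x` serves as test function: the derivative of the convolution becomes
  -- the average of `G` against `ψ ≥ 0`, whose integral is `1`, so the bound by `c` survives.
  set ψ : 𝔼 → ℝ := fun z => ρ (x - z) with hψ
  have hψs : ContDiff ℝ ∞ ψ := hρs.comp (by fun_prop)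
  have hψ0 : ∀ z, z ∉ Metric.closedBall x b.rOut → ρ (x - z) = 0 := fun z hz => by
    have : x - z ∉ Function.support ρ := by
      rw [hρ, b.support_normed_eq, Metric.mem_ball, dist_zero_right, ← dist_eq_norm, dist_comm]
      exact fun h => hz (Metric.mem_closedBall.2 h.le)
    simpa using this
  have hψt : tsupport ψ ⊆ Metric.closedBall x b.rOut :=
    closure_minimal (fun z hz => by
      by_contra h
      exact hz (hψ0 z h)) Metric.isClosed_closedBall
  have hψc : HasCompactSupport ψ :=
    (isCompact_closedBall x b.rOut).of_isClosed_subset (isClosed_tsupport ψ) hψt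
  have hψd : ∀ z w, fderiv ℝ ψ z w = -fderiv ℝ ρ (x - z) w := fun z w => by
    have h1 : HasFDerivAt ρ (fderiv ℝ ρ (x - z)) (x - z) :=
      ((hρs.differentiable (by simp)) (x - z)).hasFDerivAt
    have h2 : HasFDerivAt (fun z : 𝔼 => x - z) (-ContinuousLinearMap.id ℝ 𝔼) z :=
      (hasFDerivAt_id z).const_sub x
    have h3 := (h1.comp z h2).fderiv
    have h4 : fderiv ℝ ψ z = (fderiv ℝ ρ (x - z)).comp (-ContinuousLinearMap.id ℝ 𝔼) := h3
    rw [h4]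
    simp
  have hint := (hρc.fderiv (𝕜 := ℝ)).convolutionExists_left
    ((ContinuousLinearMap.lsmul ℝ ℝ : ℝ →L[ℝ] ℝ →L[ℝ] ℝ).precompL 𝔼)
    (hρs.continuous_fderiv (by simp)) hu'.locallyIntegrable x
  rw [convolution_def, ContinuousLinearMap.integral_apply hint]
  have e1 : ∫ t, (((ContinuousLinearMap.lsmul ℝ ℝ : ℝ →L[ℝ] ℝ →L[ℝ] ℝ).precompL 𝔼)
      (fderiv ℝ ρ t) (K.indicator u (x - t))) v = ∫ z, -(u z * fderiv ℝ ψ z v) := by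
    rw [← integral_sub_left_eq_self _ volume x]
    refine integral_congr_ae (Eventually.of_forall fun z => ?_)
    simp only [sub_sub_cancel, ContinuousLinearMap.precompL_apply, ContinuousLinearMap.lsmul_apply,
      smul_eq_mul, hψd]
    by_cases hz : z ∈ K
    · simp [indicator_of_mem hz, mul_comm]
    · have h1 : fderiv ℝ ψ z = 0 := image_eq_zero_of_notMem_tsupport fun h =>
        hz (hx (hψt (tsupport_fderiv_subset ℝ h)))
      have h2 := hψd z v
      rw [h1] at h2
      simp [indicator_of_notMem hz, ← h2]
  rw [e1, integral_neg, hw ψ hψs hψc (hψt.trans (hx.trans hKU)) v, neg_neg, ← integral_neg]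
  have hGi : Integrable fun z => -(G z v * ψ z) := by
    have h1 : IntegrableOn (fun z => G z v) K :=
      (ContinuousLinearMap.apply ℝ ℝ v).integrable_comp (hG.integrableOn hKU hK)
    have h2 : IntegrableOn (fun z => G z v * ψ z) K :=
      h1.mul_continuousOn hψs.continuous.continuousOn hK
    refine ((integrableOn_iff_integrable_of_support_subset fun z hz => ?_).1 h2).neg
    by_contra h
    exact hz (by simp [hψ, hψ0 z fun h' => h (hx h')])
  have hψi : Integrable ψ := hψs.continuous.integrable_of_hasCompactSupport hψc
  have hψ1 : ∫ z, ψ z = 1 := by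
    rw [hψ, integral_sub_left_eq_self ρ volume x]
    exact b.integral_normed
  calc ∫ z, -(G z v * ψ z) ≤ ∫ z, c * ψ z := by
        refine integral_mono_ae hGi (hψi.const_mul c) ?_
        filter_upwards [hc] with z hz
        by_cases h : z ∈ K
        · rw [← neg_mul]
          exact mul_le_mul_of_nonneg_right (hz h) (b.nonneg_normed _)
        · simp [hψ, hψ0 z fun h' => h (hx h')]
    _ = c := by rw [integral_const_mul, hψ1, mul_one]

/-- A directional bound `-G ≤ N` on the weak derivative `G` of `u` on a ball yields the
corresponding bound on the increments of `u`, outside a null set. -/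
theorem exists_ae_sub_le_of_weakDeriv (hu : MemL2Loc U u) (hG : MemL2Loc U G)
    (hw : IsWeakDerivOn U u G) {z₀ : 𝔼} {R : ℝ} (hR : 0 < R) (hRU : Metric.closedBall z₀ R ⊆ U)
    {N : 𝔼 → ℝ} (hN : ∀ v, ∀ᵐ z : 𝔼, z ∈ Metric.closedBall z₀ R → -G z v ≤ N v) :
    ∃ S : Set 𝔼, (∀ᵐ x : 𝔼, x ∈ S) ∧ ∀ x ∈ Metric.ball z₀ (R / 2) ∩ S,
      ∀ y ∈ Metric.ball z₀ (R / 2) ∩ S, u x - u y ≤ N (y - x) := by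
  set K : Set 𝔼 := Metric.closedBall z₀ R
  have hK : IsCompact K := isCompact_closedBall z₀ R
  have huK := hu.integrableOn hRU hK
  have hu' : Integrable (K.indicator u) := (integrable_indicator_iff hK.measurableSet).2 huK
  have hpos : ∀ k : ℕ, 0 < R / (8 * (k + 1)) := fun k => by positivity
  -- The fixed ratio `2` of the radii is what a.e. convergence of the mollifications requires; outer
  -- radii at most `R / 2` keep the averages over points of the half ball inside `K`.
  set b : ℕ → ContDiffBump (0 : 𝔼) := fun k =>
    ⟨R / (8 * (k + 1)), 2 * (R / (8 * (k + 1))), hpos k, by linarith [hpos k]⟩ with hb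
  have hbR : ∀ k, (b k).rOut ≤ R / 2 := fun k => by
    have h1 : R / (8 * (k + 1)) ≤ R / 8 := by
      apply div_le_div_of_nonneg_left hR.le (by norm_num)
      have : (0 : ℝ) ≤ k := Nat.cast_nonneg k
      linarith
    simp only [hb]
    linarith
  have hb0 : Tendsto (fun k => (b k).rOut) atTop (𝓝 0) := by
    have h1 : Tendsto (fun k : ℕ => (R / 4) * (1 / ((k : ℝ) + 1))) atTop (𝓝 ((R / 4) * 0)) :=
      tendsto_one_div_add_atTop_nhds_zero_nat.const_mul _
    rw [mul_zero] at h1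
    refine h1.congr fun k => ?_
    simp only [hb]
    field_simp
    norm_num
  have hconv := ContDiffBump.ae_convolution_tendsto_right_of_locallyIntegrable (μ := volume)
    (K := 2) hb0 (Eventually.of_forall fun k => le_rfl) hu'.locallyIntegrable
  -- `S` is the set where the mollifications converge. It does not depend on a direction: the null
  -- set in `hN` is absorbed by the integral defining the mollification.
  refine ⟨_, hconv, ?_⟩
  rintro x ⟨hx, hxS⟩ y ⟨hy, hyS⟩
  have hsub : Metric.ball z₀ (R / 2) ⊆ K := fun z hz => by
    have := Metric.mem_ball.1 hz
    exact Metric.mem_closedBall.2 (by linarith)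
  have hlim : Tendsto _ atTop (𝓝 (K.indicator u x - K.indicator u y)) :=
    (show Tendsto _ _ _ from hxS).sub (show Tendsto _ _ _ from hyS)
  rw [indicator_of_mem (hsub hx), indicator_of_mem (hsub hy)] at hlim
  refine le_of_tendsto hlim (Eventually.of_forall fun k => ?_)
  set w := convolution ((b k).normed volume) (K.indicator u) (ContinuousLinearMap.lsmul ℝ ℝ) volume
  have hseg : ∀ t ∈ Icc (0 : ℝ) 1, x + t • (y - x) ∈ Metric.ball z₀ (R / 2) := fun t ht =>
    (convex_ball z₀ (R / 2)).add_smul_sub_mem hx hy ht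
  have hd : ∀ t ∈ Icc (0 : ℝ) 1, ∃ a : ℝ, HasDerivAt (fun t : ℝ => w (x + t • (y - x))) a t ∧
      -N (y - x) ≤ a := fun t ht => by
    obtain ⟨A, hA, hAN⟩ := neg_fderiv_convolution_le hG hw hK hRU huK (b k)
      (x := x + t • (y - x)) (fun z hz => by
        have h1 := Metric.mem_closedBall.1 hz
        have h2 := Metric.mem_ball.1 (hseg t ht)
        have h3 := dist_triangle z (x + t • (y - x)) z₀
        exact Metric.mem_closedBall.2 (by linarith [hbR k])) (hN (y - x))
    have h2 : HasDerivAt (fun t : ℝ => x + t • (y - x)) (y - x) t := by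
      simpa using ((hasDerivAt_id t).smul_const (y - x)).const_add x
    have hA' : HasFDerivAt w A (x + t • (y - x)) := hA
    have h3 : HasDerivAt (w ∘ fun t : ℝ => x + t • (y - x)) (A (y - x)) t :=
      hA'.comp_hasDerivAt t h2
    exact ⟨A (y - x), h3, by linarith⟩
  -- The mean value inequality on the segment from `x` to `y` uses the derivative bound in the
  -- single direction `y - x`.
  have hmv := (convex_Icc (0 : ℝ) 1).mul_sub_le_image_sub_of_le_deriv
    (f := fun t : ℝ => w (x + t • (y - x))) (C := -N (y - x))
    (fun t ht => by
      obtain ⟨a, ha, -⟩ := hd t ht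
      exact ha.continuousAt.continuousWithinAt)
    (fun t ht => by
      obtain ⟨a, ha, -⟩ := hd t (interior_subset ht)
      exact ha.differentiableAt.differentiableWithinAt)
    (fun t ht => by
      obtain ⟨a, ha, hle⟩ := hd t (interior_subset ht)
      rwa [ha.deriv])
    0 (by simp) 1 (by simp) zero_le_one
  simp only [one_smul, zero_smul, add_zero, add_sub_cancel] at hmv
  linarith

end Mollification

/-! ### Lipschitz representatives of Sobolev functions -/

/-- A function that is locally a.e. equal to a continuous function is a.e. equal to a
continuous function. -/
theorem exists_continuous_ae_eq {X : Type*} [TopologicalSpace X] [SecondCountableTopology X]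
    [MeasurableSpace X] {μ : Measure X} [μ.IsOpenPosMeasure] {f : X → ℝ}
    (h : ∀ x, ∃ V, IsOpen V ∧ x ∈ V ∧ ∃ g : X → ℝ, ContinuousOn g V ∧
      ∀ᵐ y ∂μ, y ∈ V → f y = g y) :
    ∃ g : X → ℝ, Continuous g ∧ f =ᵐ[μ] g := by
  have hne : ∀ x : X, (𝓝 x ⊓ ae μ).NeBot := fun x => by
    rw [inf_neBot_iff]
    intro s hs t ht
    have h1 : Dense t := Measure.dense_of_ae (μ := μ) (p := (· ∈ t)) ht
    exact (mem_closure_iff_nhds.1 (h1 x)) s hs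
  choose V hVo hxV g hg hfg using h
  -- An intrinsic limit of `f` along conull sets, which are dense. It agrees with every local
  -- continuous representative, so no compatibility on overlaps has to be checked.
  set f' : X → ℝ := fun x => limUnder (𝓝 x ⊓ ae μ) f with hf'
  have key : ∀ x, EqOn f' (g x) (V x) := fun x y hy => by
    have : (𝓝 y ⊓ ae μ).NeBot := hne y
    have h1 : Tendsto (g x) (𝓝 y ⊓ ae μ) (𝓝 (g x y)) :=
      ((hg x).continuousAt ((hVo x).mem_nhds hy)).mono_left inf_le_left
    refine (h1.congr' ?_).limUnder_eq
    have h2 : ∀ᶠ z in 𝓝 y ⊓ ae μ, z ∈ V x := mem_inf_of_left ((hVo x).mem_nhds hy)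
    have h3 : ∀ᶠ z in 𝓝 y ⊓ ae μ, z ∈ V x → f z = g x z := mem_inf_of_right (hfg x)
    filter_upwards [h2, h3] with z hz hz'
    exact (hz' hz).symm
  refine ⟨f', continuous_iff_continuousAt.2 fun x => ?_, ae_of_locally_ae fun x =>
    ⟨V x, (hVo x).mem_nhds (hxV x), ?_⟩⟩
  · exact ((hg x).congr (key x)).continuousAt ((hVo x).mem_nhds (hxV x))
  · filter_upwards [hfg x] with y hy hyV
    rw [hy hyV, key x hyV]

namespace FinslerStructure

variable [IsManifold (𝓡 n) ∞ M] {F : FinslerStructure n M}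
  {φ : OpenPartialHomeomorph M (EuclideanSpace ℝ (Fin n))} {f : M → ℝ}

section Representative

variable [SecondCountableTopology M] [MeasurableSpace M] [BorelSpace M] {m : Measure M}

/-- In the chart the dual bound reads `-G z v ≤ F.chartNorm φ z v`. Freezing the norm at `z₀` costs
`δ‖v‖` on a small ball and makes the bound independent of `z`, as mollification requires. -/
theorem exists_ae_sub_le_of_mem_sobolevClass (hm : IsSmoothPositiveMeasure n m)
    (hf : f ∈ F.sobolevClass m) (hφ : φ ∈ IsManifold.maximalAtlas (𝓡 n) ∞ M)
    {z₀ : 𝔼} (hz₀ : z₀ ∈ φ.target) {δ : ℝ} (hδ : 0 < δ) :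
    ∃ r : ℝ, 0 < r ∧ Metric.ball z₀ r ⊆ φ.target ∧ ∃ S : Set 𝔼, (∀ᵐ x : 𝔼, x ∈ S) ∧
      ∀ x ∈ Metric.ball z₀ r ∩ S, ∀ y ∈ Metric.ball z₀ r ∩ S,
        f (φ.symm x) - f (φ.symm y) ≤ F.chartNorm φ z₀ (y - x) + δ * ‖y - x‖ := by
  obtain ⟨-, θ, hθ, hdual⟩ := hf
  obtain ⟨hu, hG, hw⟩ := hθ φ hφ
  have h1 := (F.eventually_abs_chartNorm_sub_le hφ hz₀ hδ).and (φ.open_target.mem_nhds hz₀)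
  obtain ⟨R, hR, h⟩ := Metric.nhds_basis_closedBall.eventually_iff.1 h1
  obtain ⟨S, hS, hSle⟩ := exists_ae_sub_le_of_weakDeriv hu hG hw hR (fun z hz => (h hz).2)
    (N := fun v => F.chartNorm φ z₀ v + δ * ‖v‖) (fun v => by
      filter_upwards [hm.ae_chart hφ hdual] with z hz hzR
      have h2 : -inChart φ θ z v ≤ F.chartNorm φ z v :=
        F.le_of_dual_le_one (hz (h hzR).2) (mfderiv 𝓘(ℝ, 𝔼) (𝓡 n) φ.symm z v)
      have h3 := (abs_le.1 ((h hzR).1 v)).2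
      linarith)
  refine ⟨R / 2, by positivity, fun z hz => (h ?_).2, S, hS, hSle⟩
  have := Metric.mem_ball.1 hz
  exact Metric.mem_closedBall.2 (by linarith)

/-- The a.e. increment bound with `δ = 1` makes `f` Lipschitz on a conull part of a chart ball,
hence extendable; the local extensions are then glued. -/
theorem exists_continuous_representative (hm : IsSmoothPositiveMeasure n m)
    (hf : f ∈ F.sobolevClass m) : ∃ g : M → ℝ, Continuous g ∧ f =ᵐ[m] g := by
  have := hm.isOpenPosMeasure
  refine exists_continuous_ae_eq fun x₀ => ?_
  set φ := chartAt 𝔼 x₀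
  have hφ : φ ∈ IsManifold.maximalAtlas (𝓡 n) ∞ M := IsManifold.chart_mem_maximalAtlas x₀
  have hx₀ : x₀ ∈ φ.source := mem_chart_source 𝔼 x₀
  have hz₀ : φ x₀ ∈ φ.target := φ.map_source hx₀
  obtain ⟨r, hr, hrφ, S, hS, hle⟩ := exists_ae_sub_le_of_mem_sobolevClass hm hf hφ hz₀ one_pos
  obtain ⟨C, hC0, hC⟩ := F.exists_chartNorm_le hφ hz₀
  have key : ∀ x ∈ Metric.ball (φ x₀) r ∩ S, ∀ y ∈ Metric.ball (φ x₀) r ∩ S,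
      f (φ.symm x) - f (φ.symm y) ≤ (C + 1) * Dist.dist x y := by
    intro x hx y hy
    have h3 := hle x hx y hy
    have h4 := hC (y - x)
    rw [dist_comm, dist_eq_norm]
    linarith
  have hlip : LipschitzOnWith (C + 1).toNNReal (f ∘ φ.symm) (Metric.ball (φ x₀) r ∩ S) := by
    refine LipschitzOnWith.of_dist_le_mul fun x hx y hy => ?_
    rw [Real.dist_eq, abs_le, Real.coe_toNNReal _ (by positivity)]
    have h3 := key x hx y hy
    have h4 := key y hy x hx
    rw [dist_comm] at h4
    simp only [Function.comp]
    constructor <;> linarith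
  obtain ⟨g, hg, hgf⟩ := hlip.extend_real
  refine ⟨φ.source ∩ φ ⁻¹' Metric.ball (φ x₀) r, φ.isOpen_inter_preimage Metric.isOpen_ball,
    ⟨hx₀, Metric.mem_ball_self hr⟩, g ∘ φ,
    hg.continuous.comp_continuousOn (φ.continuousOn.mono inter_subset_left), ?_⟩
  have h1 : ∀ᵐ y : 𝔼, y ∈ φ.target →
      (φ (φ.symm y) ∈ Metric.ball (φ x₀) r → f (φ.symm y) = g (φ (φ.symm y))) := by
    filter_upwards [hS] with y hy hyt hyb
    rw [φ.right_inv hyt] at hyb ⊢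
    exact hgf ⟨hyb, hy⟩
  filter_upwards [hm.ae_of_ae_chart (p := fun x => φ x ∈ Metric.ball (φ x₀) r → f x = g (φ x))
    hφ h1] with x hx hxV
  exact hx hxV.1 hxV.2

/-- The increment bound holds on a conull, hence dense, subset of a ball and passes to all its
points by continuity. -/
theorem hasSlopeBound_of_ae_eq (hm : IsSmoothPositiveMeasure n m) (hf : f ∈ F.sobolevClass m)
    {g : M → ℝ} (hg : Continuous g) (hfg : f =ᵐ[m] g) : F.HasSlopeBound g := by
  intro φ hφ z₀ hz₀ δ hδ
  obtain ⟨r, hr, hrφ, S, hS, hle⟩ := exists_ae_sub_le_of_mem_sobolevClass hm hf hφ hz₀ hδ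
  have hS' : Dense {z : 𝔼 | z ∈ S ∧ (z ∈ φ.target → f (φ.symm z) = g (φ.symm z))} :=
    Measure.dense_of_ae (μ := volume) (hS.and (hm.ae_chart hφ hfg))
  set D := Metric.ball z₀ r ∩ {z : 𝔼 | z ∈ S ∧ (z ∈ φ.target → f (φ.symm z) = g (φ.symm z))}
  have hD : Metric.ball z₀ r ⊆ closure D := hS'.open_subset_closure_inter Metric.isOpen_ball
  refine Metric.eventually_nhds_iff_ball.2 ⟨r, hr, ?_⟩
  rw [← ball_prod_same]
  rintro ⟨x, y⟩ ⟨hx, hy⟩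
  have hgc : ∀ z ∈ Metric.ball z₀ r, ContinuousAt (fun z => g (φ.symm z)) z := fun z hz =>
    hg.continuousAt.comp (φ.continuousAt_symm (hrφ hz))
  have hΦ : Continuous fun v => F.chartNorm φ z₀ v :=
    (F.continuousOn_chartNorm hφ).comp_continuous (f := fun v : 𝔼 => (z₀, v)) (by fun_prop)
      (fun v => ⟨hz₀, mem_univ _⟩)
  have hcl : (x, y) ∈ closure (D ×ˢ D) := by
    rw [closure_prod_eq]
    exact ⟨hD hx, hD hy⟩
  refine ContinuousWithinAt.closure_le (s := D ×ˢ D)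
    (f := fun p : 𝔼 × 𝔼 => g (φ.symm p.1) - g (φ.symm p.2))
    (g := fun p : 𝔼 × 𝔼 => F.chartNorm φ z₀ (p.2 - p.1) + δ * ‖p.2 - p.1‖) hcl ?_ ?_ ?_
  · have h1 : ContinuousAt (fun p : 𝔼 × 𝔼 => g (φ.symm p.1)) (x, y) :=
      ContinuousAt.comp (f := Prod.fst) (g := fun z => g (φ.symm z)) (hgc x hx) continuousAt_fst
    have h2 : ContinuousAt (fun p : 𝔼 × 𝔼 => g (φ.symm p.2)) (x, y) :=
      ContinuousAt.comp (f := Prod.snd) (g := fun z => g (φ.symm z)) (hgc y hy) continuousAt_snd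
    exact (h1.sub h2).continuousWithinAt
  · have : Continuous fun p : 𝔼 × 𝔼 => F.chartNorm φ z₀ (p.2 - p.1) + δ * ‖p.2 - p.1‖ :=
      (hΦ.comp (by fun_prop)).add (by fun_prop)
    exact this.continuousWithinAt
  · rintro ⟨a, b⟩ ⟨ha, hb⟩
    simp only
    rw [← ha.2.2 (hrφ ha.1), ← hb.2.2 (hrφ hb.1)]
    exact hle a ⟨ha.1, ha.2.1⟩ b ⟨hb.1, hb.2.1⟩

/-- Every element of the class `𝕃` has a continuous representative that is `1`-Lipschitz for
the Finsler distance. -/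
theorem exists_lipschitz_representative (hm : IsSmoothPositiveMeasure n m)
    (hf : f ∈ F.sobolevClass m) : ∃ g : M → ℝ, Continuous g ∧ f =ᵐ[m] g ∧
      ∀ x y, ENNReal.ofReal (g x - g y) ≤ F.dist x y := by
  obtain ⟨g, hg, hfg⟩ := exists_continuous_representative hm hf
  exact ⟨g, hg, hfg, (hasSlopeBound_of_ae_eq hm hf hg hfg).ofReal_sub_le_dist⟩

end Representative

end FinslerStructure

/-! ### Distance functions: maximality and equality of the set distances -/

namespace FinslerStructure

variable [IsManifold (𝓡 n) ∞ M] (F : FinslerStructure n M)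

theorem distTo_le_add (B : Set M) (x y : M) : F.distTo B x ≤ F.dist x y + F.distTo B y := by
  unfold distTo
  simp only [ENNReal.add_iInf]
  exact le_iInf₂ fun z hz => (iInf₂_le z hz).trans (F.dist_triangle x y z)

theorem dist_self (x : M) : F.dist x x = 0 := by
  have hφ : chartAt 𝔼 x ∈ IsManifold.maximalAtlas (𝓡 n) ∞ M := IsManifold.chart_mem_maximalAtlas x
  have hx : x ∈ (chartAt 𝔼 x).source := mem_chart_source 𝔼 x
  have h := F.dist_chart_symm_le hφ (x := chartAt 𝔼 x x) (y := chartAt 𝔼 x x) (fun t _ => by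
    simp)
  rw [(chartAt 𝔼 x).left_inv hx] at h
  simpa [F.chartNorm_zero] using h

theorem distTo_eq_zero_of_mem {B : Set M} {x : M} (hx : x ∈ B) : F.distTo B x = 0 :=
  le_antisymm ((iInf₂_le x hx).trans (F.dist_self x).le) bot_le

/-- The truncated distance `d_B ∧ R`. -/
def truncDistTo (B : Set M) (R : ℝ) (x : M) : ℝ := (min (F.distTo B x) (ENNReal.ofReal R)).toReal

theorem truncDistTo_nonneg (B : Set M) (R : ℝ) (x : M) : 0 ≤ F.truncDistTo B R x :=
  ENNReal.toReal_nonneg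

theorem truncDistTo_le (B : Set M) {R : ℝ} (hR : 0 ≤ R) (x : M) : F.truncDistTo B R x ≤ R := by
  unfold truncDistTo
  rw [← ENNReal.toReal_ofReal hR]
  exact ENNReal.toReal_mono (by simp) (by rw [ENNReal.toReal_ofReal hR]; exact min_le_right _ _)

theorem ofReal_truncDistTo (B : Set M) (R : ℝ) (x : M) :
    ENNReal.ofReal (F.truncDistTo B R x) = min (F.distTo B x) (ENNReal.ofReal R) :=
  ENNReal.ofReal_toReal (ne_top_of_le_ne_top ENNReal.ofReal_ne_top (min_le_right _ _))

theorem truncDistTo_of_mem {B : Set M} {x : M} (R : ℝ) (hx : x ∈ B) : F.truncDistTo B R x = 0 := by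
  simp [truncDistTo, F.distTo_eq_zero_of_mem hx]

theorem hasSlopeBound_truncDistTo (B : Set M) (R : ℝ) : F.HasSlopeBound (F.truncDistTo B R) := by
  refine F.hasSlopeBound_of_ofReal_sub_le fun x y => ?_
  rw [ENNReal.ofReal_sub _ (F.truncDistTo_nonneg B R y), ofReal_truncDistTo, ofReal_truncDistTo,
    tsub_le_iff_right]
  rcases le_total (F.distTo B y) (ENNReal.ofReal R) with h | h
  · rw [min_eq_left h]
    exact (min_le_left _ _).trans (F.distTo_le_add B x y)
  · rw [min_eq_right h]
    exact (min_le_right _ _).trans le_add_self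

theorem continuous_truncDistTo (B : Set M) (R : ℝ) : Continuous (F.truncDistTo B R) :=
  (F.hasSlopeBound_truncDistTo B R).continuous

theorem iSup_min_natCast (a : ℝ≥0∞) : ⨆ k : ℕ, min a (ENNReal.ofReal k) = a := by
  simp only [ENNReal.ofReal_natCast]
  rw [← inf_iSup_eq, ENNReal.iSup_natCast, inf_top_eq]

/-- The function may be infinite, but it is the supremum of its continuous truncations. -/
theorem measurable_distTo [MeasurableSpace M] [BorelSpace M] (B : Set M) :
    Measurable (F.distTo B) := by
  have h : F.distTo B = fun x => ⨆ k : ℕ, ENNReal.ofReal (F.truncDistTo B k x) := by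
    funext x
    simp only [ofReal_truncDistTo, iSup_min_natCast]
  rw [h]
  exact Measurable.iSup fun k => (F.continuous_truncDistTo B k).measurable.ennreal_ofReal

/-- An inequality between continuous functions that holds a.e. on an open set holds there. -/
theorem _root_.FinslerVaradhan.le_of_ae_restrict_le {X : Type*} [TopologicalSpace X]
    [MeasurableSpace X] [OpensMeasurableSpace X] {μ : Measure X} [μ.IsOpenPosMeasure] {A : Set X}
    (hA : IsOpen A) {Y : Type*} [TopologicalSpace Y] [Preorder Y] [OrderClosedTopology Y]
    {f g : X → Y} (hf : Continuous f) (hg : Continuous g)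
    (h : ∀ᵐ x ∂μ.restrict A, f x ≤ g x) {x : X} (hx : x ∈ A) : f x ≤ g x := by
  rw [ae_restrict_iff' hA.measurableSet] at h
  have h1 : A ⊆ closure (A ∩ {x | x ∈ A → f x ≤ g x}) :=
    (Measure.dense_of_ae h).open_subset_closure_inter hA
  exact ContinuousWithinAt.closure_le (h1 hx) hf.continuousWithinAt hg.continuousWithinAt
    fun y hy => hy.2 hy.1

variable [SecondCountableTopology M] [MeasurableSpace M] [BorelSpace M] {m : Measure M}

theorem truncDistTo_mem_sobolevClass (hm : IsSmoothPositiveMeasure n m) (B : Set M) {R : ℝ}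
    (hR : 0 ≤ R) : F.truncDistTo B R ∈ F.sobolevClass m :=
  (F.hasSlopeBound_truncDistTo B R).mem_sobolevClass hm (C := R) fun x => by
    rw [abs_of_nonneg (F.truncDistTo_nonneg B R x)]
    exact F.truncDistTo_le B hR x

/-- Openness of `B` lets the Lipschitz representative of a competitor inherit the bound `≤ 0` at
every point of `B`, after which its Lipschitz bound is minimised over `B`. -/
theorem isMaximalSobolevDist_distTo (hm : IsSmoothPositiveMeasure n m) {B : Set M}
    (hB : IsOpen B) : F.IsMaximalSobolevDist m B (F.distTo B) where
  measurable := F.measurable_distTo B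
  mem R hR := ⟨F.truncDistTo_mem_sobolevClass hm B hR.le,
    ae_restrict_of_forall_mem hB.measurableSet fun _ hx => F.truncDistTo_of_mem R hx,
    Eventually.of_forall fun x => ⟨F.truncDistTo_nonneg B R x, F.truncDistTo_le B hR.le x⟩⟩
  maximal R hR f hf := by
    obtain ⟨hfL, hfB, hfR⟩ := hf
    have := hm.isOpenPosMeasure
    obtain ⟨g, hg, hfg, hlip⟩ := exists_lipschitz_representative hm hfL
    have hgB : ∀ y ∈ B, g y ≤ 0 := fun y hy =>
      le_of_ae_restrict_le (μ := m) (g := fun _ => (0 : ℝ)) hB hg continuous_const (by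
        filter_upwards [hfB, ae_restrict_of_ae hfg] with x h1 h2
        rw [← h2, h1]) hy
    filter_upwards [hfg, hfR] with x h1 h2
    refine (ENNReal.ofReal_le_iff_le_toReal
      (ne_top_of_le_ne_top ENNReal.ofReal_ne_top (min_le_right _ _))).1 (le_min ?_ ?_)
    · refine le_iInf₂ fun y hy => le_trans (ENNReal.ofReal_le_ofReal ?_) (hlip x y)
      rw [h1]
      linarith [hgB y hy]
    · exact ENNReal.ofReal_le_ofReal h2.2

theorem IsMaximalSobolevDist.ae_eq {B : Set M} {g g' : M → ℝ≥0∞}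
    {F : FinslerStructure n M} (hg : F.IsMaximalSobolevDist m B g)
    (hg' : F.IsMaximalSobolevDist m B g') : g =ᵐ[m] g' := by
  -- Each truncation dominates the other a.e. by maximality. The levels start at `1` because
  -- maximality is required only for `R > 0`.
  have h : ∀ k : ℕ, ∀ᵐ x ∂m, min (g x) (ENNReal.ofReal (k + 1 : ℝ)) =
      min (g' x) (ENNReal.ofReal (k + 1 : ℝ)) := fun k => by
    have hk : (0 : ℝ) < k + 1 := by positivity
    filter_upwards [hg.maximal _ hk _ (hg'.mem _ hk), hg'.maximal _ hk _ (hg.mem _ hk)]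
      with x h1 h2
    refine (ENNReal.toReal_eq_toReal_iff' ?_ ?_).1 (le_antisymm h2 h1) <;>
    exact ne_top_of_le_ne_top ENNReal.ofReal_ne_top (min_le_right _ _)
  filter_upwards [ae_all_iff.2 h] with x hx
  have key : ∀ a : ℝ≥0∞, ⨆ k : ℕ, min a (ENNReal.ofReal (k + 1 : ℝ)) = a := fun a => by
    refine le_antisymm (iSup_le fun k => min_le_left _ _) ?_
    conv_lhs => rw [← iSup_min_natCast a]
    exact iSup_mono fun k => min_le_min_left _ (ENNReal.ofReal_le_ofReal (by linarith))
  rw [← key (g x), ← key (g' x)]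
  exact iSup_congr hx

/-- On an open set an a.e. lower bound for a continuous function holds everywhere; this is applied
to truncations of `d_B`, whose levels then tend to infinity. -/
theorem essSetDist_eq_setDist (hm : IsSmoothPositiveMeasure n m) {A : Set M} (hA : IsOpen A)
    (B : Set M) : F.essSetDist m A B = F.setDist A B := by
  have := hm.isOpenPosMeasure
  refine le_antisymm (le_iInf₂ fun x hx => ?_) ?_
  · set c := F.essSetDist m A B with hc
    change c ≤ F.distTo B x
    have h1 : ∀ᵐ y ∂m.restrict A, c ≤ F.distTo B y := ae_essInf_le
    rw [← iSup_min_natCast c]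
    refine iSup_le fun k => ?_
    have h2 : min c (ENNReal.ofReal k) ≤ ENNReal.ofReal (F.truncDistTo B k x) :=
      le_of_ae_restrict_le (μ := m) (f := fun _ => min c (ENNReal.ofReal k))
        (g := fun y => ENNReal.ofReal (F.truncDistTo B k y)) hA continuous_const
        (ENNReal.continuous_ofReal.comp (F.continuous_truncDistTo B k)) (by
          filter_upwards [h1] with y hy
          rw [ofReal_truncDistTo]
          exact min_le_min_right _ hy) hx
    rw [ofReal_truncDistTo] at h2
    exact h2.trans (min_le_left _ _)
  · refine le_essInf_of_ae_le _ (ae_restrict_of_forall_mem hA.measurableSet fun x hx => ?_)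
    exact iInf₂_le x hx

theorem sobolevSetDist_le (hm : IsSmoothPositiveMeasure n m) {A B : Set M} (hA : IsOpen A)
    (hB : IsOpen B) : F.sobolevSetDist m A B ≤ (F.setDist A B : EReal) := by
  have := hm.isOpenPosMeasure
  refine iSup₂_le fun f hf => ?_
  obtain ⟨g, hg, hfg, hlip⟩ := exists_lipschitz_representative hm hf
  have hgE : Continuous fun x => (g x : EReal) := continuous_coe_real_ereal.comp hg
  have hAle : ∀ x ∈ A, essInf (fun x => (f x : EReal)) (m.restrict A) ≤ (g x : EReal) :=
    fun x hx => le_of_ae_restrict_le (μ := m) (f := fun _ => essInf (fun x => (f x : EReal))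
      (m.restrict A)) hA continuous_const hgE (by
        filter_upwards [ae_essInf_le (f := fun x => (f x : EReal)) (μ := m.restrict A),
          ae_restrict_of_ae hfg] with y h1 h2
        rwa [h2] at h1) hx
  have hBle : ∀ y ∈ B, (g y : EReal) ≤ essSup (fun x => (f x : EReal)) (m.restrict B) :=
    fun y hy => le_of_ae_restrict_le (μ := m) (g := fun _ => essSup (fun x => (f x : EReal))
      (m.restrict B)) hB hgE continuous_const (by
        filter_upwards [ae_le_essSup (f := fun x => (f x : EReal)) (μ := m.restrict B),
          ae_restrict_of_ae hfg] with y h1 h2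
        rwa [h2] at h1) hy
  have key : ∀ x ∈ A, ∀ y ∈ B, essInf (fun x => (f x : EReal)) (m.restrict A) -
      essSup (fun x => (f x : EReal)) (m.restrict B) ≤ (F.dist x y : EReal) := fun x hx y hy => by
    refine (EReal.sub_le_sub (hAle x hx) (hBle y hy)).trans ?_
    rw [← EReal.coe_sub]
    refine le_trans ?_ (EReal.coe_ennreal_le_coe_ennreal_iff.2 (hlip x y))
    rw [EReal.coe_ennreal_ofReal]
    exact_mod_cast le_max_left _ _
  -- A real `c` strictly in between reduces the comparison of the infimum with an `EReal` to a
  -- single pair `(x, y)`; empty sets give the distance `⊤` and leave no room for `c`.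
  by_contra hlt
  obtain ⟨c, hc1, hc2⟩ := EReal.lt_iff_exists_real_btwn.1 (not_le.1 hlt)
  have hc0 : (0 : EReal) ≤ (c : EReal) := (EReal.coe_ennreal_nonneg _).trans hc1.le
  have hc0' : 0 ≤ c := by exact_mod_cast hc0
  have h1 : F.setDist A B < ENNReal.ofReal c := by
    rw [← EReal.coe_ennreal_lt_coe_ennreal_iff, EReal.coe_ennreal_ofReal, max_eq_left hc0']
    exact hc1
  simp only [setDist, iInf_lt_iff] at h1
  obtain ⟨x, hx, y, hy, hxy⟩ := h1
  rw [← EReal.coe_ennreal_lt_coe_ennreal_iff, EReal.coe_ennreal_ofReal, max_eq_left hc0'] at hxy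
  exact absurd (hc2.trans_le (key x hx y hy)) (not_lt.2 hxy.le)

theorem le_sobolevSetDist (hm : IsSmoothPositiveMeasure n m) {A B : Set M} (hA : IsOpen A)
    (hB : IsOpen B) : (F.setDist A B : EReal) ≤ F.sobolevSetDist m A B := by
  have hterm : ∀ k : ℕ, (min (F.setDist A B) (ENNReal.ofReal k) : ℝ≥0∞) ≤
      F.sobolevSetDist m A B := fun k => by
    refine le_iSup₂_of_le _ (F.truncDistTo_mem_sobolevClass hm B (Nat.cast_nonneg k)) ?_
    have h1 : ((min (F.setDist A B) (ENNReal.ofReal k) : ℝ≥0∞) : EReal) ≤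
        essInf (fun x => (F.truncDistTo B k x : EReal)) (m.restrict A) := by
      refine le_essInf_of_ae_le _ (ae_restrict_of_forall_mem hA.measurableSet fun x hx => ?_)
      have h2 : min (F.setDist A B) (ENNReal.ofReal k) ≤ ENNReal.ofReal (F.truncDistTo B k x) := by
        rw [ofReal_truncDistTo]
        exact min_le_min_right _ (iInf₂_le x hx)
      refine (EReal.coe_ennreal_le_coe_ennreal_iff.2 h2).trans_eq ?_
      rw [EReal.coe_ennreal_ofReal, max_eq_left (F.truncDistTo_nonneg B k x)]
    have h3 : essSup (fun x => (F.truncDistTo B k x : EReal)) (m.restrict B) ≤ 0 := by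
      refine essSup_le_of_ae_le _ (ae_restrict_of_forall_mem hB.measurableSet fun x hx => ?_)
      simp [F.truncDistTo_of_mem k hx]
    simpa using EReal.sub_le_sub h1 h3
  rw [← iSup_min_natCast (F.setDist A B)]
  by_contra hlt
  obtain ⟨c, hc1, hc2⟩ := EReal.lt_iff_exists_real_btwn.1 (not_le.1 hlt)
  have hc0 : 0 ≤ c := by
    -- The truncation at level `0` is the zero test function, which makes the supremum nonnegative.
    have h0 : (0 : EReal) ≤ F.sobolevSetDist m A B :=
      (EReal.coe_ennreal_nonneg _).trans (hterm 0)
    exact_mod_cast h0.trans hc1.le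
  have h1 : ENNReal.ofReal c < ⨆ k : ℕ, min (F.setDist A B) (ENNReal.ofReal k) := by
    rw [← EReal.coe_ennreal_lt_coe_ennreal_iff, EReal.coe_ennreal_ofReal, max_eq_left hc0]
    exact hc2
  obtain ⟨k, hk⟩ := lt_iSup_iff.1 h1
  rw [← EReal.coe_ennreal_lt_coe_ennreal_iff, EReal.coe_ennreal_ofReal, max_eq_left hc0] at hk
  exact absurd (hk.trans_le (hterm k)) (not_lt.2 hc1.le)

end FinslerStructure

end FinslerVaradhan
end

theorem lemma2p3 {n : ℕ} (hn : 2 ≤ n) {M : Type*} [TopologicalSpace M] [T2Space M]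
    [SecondCountableTopology M] [ConnectedSpace M]
    [ChartedSpace (EuclideanSpace ℝ (Fin n)) M] [IsManifold (𝓡 n) ∞ M]
    [MeasurableSpace M] [BorelSpace M]
    (F : FinslerVaradhan.FinslerStructure n M)
    (hrev : F.reversibility < ⊤) (hcomplete : F.IsForwardComplete)
    (m : Measure M) (hm : FinslerVaradhan.IsSmoothPositiveMeasure n m) :
    (∀ B : Set M, IsOpen B →
      (∃ g : M → ℝ≥0∞, F.IsMaximalSobolevDist m B g) ∧
      ∀ g : M → ℝ≥0∞, F.IsMaximalSobolevDist m B g → g =ᵐ[m] F.distTo B) ∧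
    (∀ A B : Set M, IsOpen A → IsOpen B →
      F.sobolevSetDist m A B = (F.essSetDist m A B : EReal) ∧
      F.essSetDist m A B = F.setDist A B) := by
  refine ⟨fun B hB => ⟨⟨F.distTo B, F.isMaximalSobolevDist_distTo hm hB⟩, fun g hg =>
    hg.ae_eq (F.isMaximalSobolevDist_distTo hm hB)⟩, fun A B hA hB => ?_⟩
  rw [F.essSetDist_eq_setDist hm hA B]
  exact ⟨le_antisymm (F.sobolevSetDist_le hm hA hB) (F.le_sobolevSetDist hm hA hB), rfl⟩
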